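/- **Unknown covariance.** There is an absolute constant $C\ge 1$ such that the following holds for all integers $d,n\ge 1$ and reals $R\ge 0$, $\kappa\ge 1$, $\varepsilon,\beta\in(0,1)$. Put $$\alpha = C\left(\sqrt{\frac{d+\log(1/\beta)}{n}}+\frac{d\log\left(\frac{(R+\sqrt{\kappa})\,n}{d}\right)+\log(1/\beta)}{n\varepsilon}\right),$$ and suppose that the numerator $d\log((R+\sqrt\kappa)n/d)+\log(1/\beta)$ is nonnegative and that $\alpha\le 1$. Then there is an $\varepsilon$-differentially private randomized algorithm $M:(\mathbb R^d)^n\to\mathbb R^d$ (depending only on $d,n,R,\kappa,\varepsilon,\beta$) such that for every $\mu\in\mathbb R^d$ with $\|\mu\|_2\le R$ and every symmetric $\Sigma\in\mathbb R^{d\times d}$ with $I\preceq\Sigma\preceq\kappa I$, if $S_1,\dots,S_n$ are i.i.d. from $N(\mu,\Sigma)$, then with probability at least $1-\beta$ over the sample and the randomness of $M$, $$\sqrt{(M(S_1,\dots,S_n)-\mu)^\top\Sigma^{-1}(M(S_1,\dots,S_n)-\mu)}\le\alpha .$$ **Spherical case.** There is an absolute constant $C\ge 1$ such that the following holds for all integers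 $d,n\ge 1$ and reals $R>0$, $\varepsilon,\beta\in(0,1)$. Put $$\alpha = C\left(\sqrt{\frac{d+\log(1/\beta)}{n}}+\frac{d\log\left(\frac{Rn}{d}\right)+\log(1/\beta)}{n\varepsilon}\right),$$ and suppose that the numerator $d\log(Rn/d)+\log(1/\beta)$ is nonnegative and that $\alpha\le 1$. Then there is an $\varepsilon$-differentially private randomized algorithm $M:(\mathbb R^d)^n\to\mathbb R^d$ (depending only on $d,n,R,\varepsilon,\beta$) such that for every $\mu\in\mathbb R^d$ with $\|\mu\|_2\le R$, if $S_1,\dots,S_n$ are i.i.d. from $N(\mu,I)$, then $\|M(S_1,\dots,S_n)-\mu\|_2\le\alpha$ with probability at least $1-\beta$ over the sample and the randomness of $M$. Here a randomized algorithm is a Markov kernel from $(\mathbb R^d)^n$ to $\mathbb R^d$, and $M$ is $\varepsilon$-differentially private if $\Pr[M(D)\in T]\le e^{\varepsilon}\Pr[M(D')\in T]$ for all measurable $T\subseteq\mathbb R^d$ and all $D,D'\in(\mathbb R^d)^n$ that differ in at most one entry. -/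

import Mathlib

open MeasureTheory ProbabilityTheory

open Classical in
/-- A randomized algorithm on data sets of `n` entries from `X` with outputs in `Y` is a Markov
kernel. It is `ε`-differentially private if, for all data sets `D`, `D'` at Hamming distance at
most one and every measurable `T`, `Pr[M(D) ∈ T] ≤ exp(ε) Pr[M(D') ∈ T]`. -/
def IsPureDP {X Y : Type*} [MeasurableSpace X] [MeasurableSpace Y] {n : ℕ} (ε : ℝ)
    (M : Kernel (Fin n → X) Y) : Prop :=
  IsMarkovKernel M ∧
    ∀ D D' : Fin n → X, hammingDist D D' ≤ 1 →
      ∀ T : Set Y, MeasurableSet T → M D T ≤ ENNReal.ofReal (Real.exp ε) * M D' T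

/-- The law of `M(S_1, …, S_n)`, where the `S_i` are independent with law `P` and the internal
randomness of `M` is independent of the sample. -/
noncomputable def outputLaw {X Y : Type*} [MeasurableSpace X] [MeasurableSpace Y] {n : ℕ}
    (M : Kernel (Fin n → X) Y) (P : Measure X) : Measure Y :=
  (Measure.pi fun _ : Fin n => P).bind M

/-- The Mahalanobis norm `√(vᵀ S⁻¹ v)`; used for positive definite `S` only. -/
noncomputable def mahalanobisNorm {d : ℕ} (S : Matrix (Fin d) (Fin d) ℝ)
    (v : EuclideanSpace ℝ (Fin d)) : ℝ :=
  Real.sqrt (v.ofLp ⬝ᵥ S⁻¹.mulVec v.ofLp)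

/-- `d log(r n / d) + log(1/β)`, the numerator of the privacy term of the error bound. -/
noncomputable def privacyCost (d n : ℕ) (r β : ℝ) : ℝ :=
  d * Real.log (r * n / d) + Real.log (1 / β)

/-- `C (√((d + log(1/β)) / n) + (d log(r n / d) + log(1/β)) / (n ε))`. -/
noncomputable def errorBound (C : ℝ) (d n : ℕ) (r ε β : ℝ) : ℝ :=
  C * (Real.sqrt ((d + Real.log (1 / β)) / n) + privacyCost d n r β / (n * ε))

open scoped RealInnerProductSpace ENNReal

/-! ### Symmetrization, contraction and a uniform law for Lipschitz functions -/

/-! The estimator is an exponential mechanism on a Euclidean ball, driven by a smoothed Tukey depth.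
`score` is an infimum over test vectors, so a linear change of the data merely reparametrizes the
tests. It is therefore exactly affine equivariant (`score_affine`), and after whitening by `Σ^{1/2}`
one may argue as if the sample were standard Gaussian, although the mechanism never sees `Σ`.

For a standard Gaussian sample the score separates candidates. Write `l = truncMean / 12` and let
`b` be of order `√((d + log(1/β))/n)`. Candidates within `r` of the centre score at least `-n(b+r)`
(`le_score_of_norm_le`), while those at distance at least `α` score at most `n(b - lα/4)`
(`score_le_of_le_norm`). The penalty in `testValue` makes tests longer than the spread of the data
harmless, so only `‖v‖ ≤ 1` needs uniform control. That control comes from symmetrization and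
contraction at the level of exponential moments, which reduces everything to the norm of a Gaussian
sum (`measure_exists_sum_gt_le`).

Replacing one point changes the score by a bounded amount, which gives privacy. For accuracy, `Σ ⪰
I` makes `Σ^{1/2}` norm-increasing, so a Euclidean ball of radius `r` about `μ` consists of good
candidates. Its volume relative to the base ball costs `(2ρ/r)^d`. The score gap contributes a
factor at most `exp(-privacyCost)`, which pays for that cost since `r` is at least of order `d/n`.
-/

lemma exp_add_exp_le_exp_add_exp {x y x' y' : ℝ} (h0 : y ≤ x) (h1 : x - y ≤ x' - y')
    (h2 : y ≤ y') : Real.exp x + Real.exp y' ≤ Real.exp x' + Real.exp y := by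
  have e1 : Real.exp x = Real.exp y * Real.exp (x - y) := by rw [← Real.exp_add]; ring_nf
  have e2 : Real.exp x' = Real.exp y' * Real.exp (x' - y') := by rw [← Real.exp_add]; ring_nf
  have h3 : Real.exp (x - y) ≤ Real.exp (x' - y') := Real.exp_le_exp.2 h1
  have h4 : 1 ≤ Real.exp (x - y) := Real.one_le_exp (by linarith)
  have h5 : Real.exp y ≤ Real.exp y' := Real.exp_le_exp.2 h2
  have h6 := Real.exp_pos y
  rw [e1, e2]
  nlinarith

/-- The two-point comparison behind the Ledoux-Talagrand contraction principle. -/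
lemma exp_sup'_contraction {ι : Type*} (V : Finset ι) (hV : V.Nonempty) (a F G : ι → ℝ)
    (h0 : ∀ v ∈ V, |F v| ≤ |G v|) (h : ∀ v ∈ V, ∀ w ∈ V, |F v - F w| ≤ |G v - G w|) :
    Real.exp (V.sup' hV fun v => a v + F v) + Real.exp (V.sup' hV fun v => a v - F v) ≤
      Real.exp (V.sup' hV fun v => a v + G v) + Real.exp (V.sup' hV fun v => a v - G v) := by
  obtain ⟨v, hv, ev⟩ := V.exists_mem_eq_sup' hV fun v => a v + F v
  obtain ⟨w, hw, ew⟩ := V.exists_mem_eq_sup' hV fun v => a v - F v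
  have p1 : a w + F w ≤ a v + F v := ev ▸ Finset.le_sup' (fun v => a v + F v) hw
  have q1 : a v - F v ≤ a w - F w := ew ▸ Finset.le_sup' (fun v => a v - F v) hv
  have P1 := Finset.le_sup' (fun v => a v + G v) hv
  have P2 := Finset.le_sup' (fun v => a v + G v) hw
  have Q1 := Finset.le_sup' (fun v => a v - G v) hv
  have Q2 := Finset.le_sup' (fun v => a v - G v) hw
  rw [ev, ew]
  set P := V.sup' hV fun v => a v + G v
  set Q := V.sup' hV fun v => a v - G v
  have hv0 := h0 v hv
  have hw0 := h0 w hw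
  have hvw := h v hv w hw
  have key : ∀ x' y : ℝ, (x' ≤ P ∧ y ≤ Q) ∨ (x' ≤ Q ∧ y ≤ P) →
      Real.exp (a v + F v) + Real.exp (a w - F w) ≤ Real.exp x' + Real.exp y →
      Real.exp (a v + F v) + Real.exp (a w - F w) ≤ Real.exp P + Real.exp Q := by
    rintro x' y (⟨h1, h2⟩ | ⟨h1, h2⟩) h3
    · linarith [Real.exp_le_exp.2 h1, Real.exp_le_exp.2 h2]
    · linarith [Real.exp_le_exp.2 h1, Real.exp_le_exp.2 h2]
  have hF := abs_le.1 hvw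
  have hFv := abs_le.1 hv0
  have hFw := abs_le.1 hw0
  -- For opposite signs of `G v` and `G w` the two exponentials are bounded separately. For equal
  -- signs one exponent gains and the other loses. The gain is at least the loss, and by maximality
  -- of `v` and `w` it starts above the level where the loss ends, so convexity of `exp` concludes.
  rcases le_total 0 (G v) with gv | gv <;> rcases le_total 0 (G w) with gw | gw
  · rw [abs_of_nonneg gv] at hFv
    rw [abs_of_nonneg gw] at hFw
    rcases le_total (G w) (G v) with g | g
    · rw [abs_of_nonneg (by linarith : 0 ≤ G v - G w)] at hF
      refine key (a v + G v) (a w - G w) (Or.inl ⟨P1, Q2⟩) ?_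
      rw [add_comm (Real.exp (a v + F v))]
      exact exp_add_exp_le_exp_add_exp (by linarith) (by linarith) (by linarith)
    · rw [abs_of_nonpos (by linarith : G v - G w ≤ 0)] at hF
      refine key (a w + G w) (a v - G v) (Or.inl ⟨P2, Q1⟩) ?_
      exact exp_add_exp_le_exp_add_exp (by linarith) (by linarith) (by linarith)
  · rw [abs_of_nonneg gv] at hFv
    rw [abs_of_nonpos gw] at hFw
    refine key (a v + G v) (a w - G w) (Or.inl ⟨P1, Q2⟩) ?_
    exact add_le_add (Real.exp_le_exp.2 (by linarith)) (Real.exp_le_exp.2 (by linarith))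
  · rw [abs_of_nonpos gv] at hFv
    rw [abs_of_nonneg gw] at hFw
    refine key (a v - G v) (a w + G w) (Or.inr ⟨Q1, P2⟩) ?_
    exact add_le_add (Real.exp_le_exp.2 (by linarith)) (Real.exp_le_exp.2 (by linarith))
  · rw [abs_of_nonpos gv] at hFv
    rw [abs_of_nonpos gw] at hFw
    rcases le_total (G w) (G v) with g | g
    · rw [abs_of_nonneg (by linarith : 0 ≤ G v - G w)] at hF
      refine key (a w - G w) (a v + G v) (Or.inr ⟨Q2, P1⟩) ?_
      exact exp_add_exp_le_exp_add_exp (by linarith) (by linarith) (by linarith)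
    · rw [abs_of_nonpos (by linarith : G v - G w ≤ 0)] at hF
      refine key (a v - G v) (a w + G w) (Or.inr ⟨Q1, P2⟩) ?_
      rw [add_comm (Real.exp (a v + F v))]
      exact exp_add_exp_le_exp_add_exp (by linarith) (by linarith) (by linarith)

/-- Jensen for `exp`. In extended nonnegative form it needs no integrability of `exp X`, since
otherwise the right side is infinite. -/
lemma ofReal_exp_integral_le {Ω : Type*} [MeasurableSpace Ω] {P : Measure Ω}
    [IsProbabilityMeasure P] {X : Ω → ℝ} (hX : Integrable X P) :
    ENNReal.ofReal (Real.exp (∫ ω, X ω ∂P)) ≤ ∫⁻ ω, ENNReal.ofReal (Real.exp (X ω)) ∂P := by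
  by_cases h : Integrable (fun ω => Real.exp (X ω)) P
  · rw [← ofReal_integral_eq_lintegral_ofReal h (ae_of_all _ fun _ => (Real.exp_pos _).le)]
    exact ENNReal.ofReal_le_ofReal (convexOn_exp.map_integral_le Real.continuous_exp.continuousOn
      isClosed_univ (by simp) hX h)
  · have : ∫⁻ ω, ENNReal.ofReal (Real.exp (X ω)) ∂P = ⊤ := by
      by_contra hne
      refine h ⟨Real.continuous_exp.comp_aestronglyMeasurable hX.1, ?_⟩
      rw [hasFiniteIntegral_iff_ofReal (ae_of_all _ fun _ => (Real.exp_pos _).le)]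
      exact lt_top_iff_ne_top.2 hne
    rw [this]; exact le_top

section Contraction

variable {E : Type*} [NormedAddCommGroup E] [InnerProductSpace ℝ E]
  [MeasurableSpace E] [BorelSpace E]

lemma integrable_lipschitz_inner {P : Measure E} [IsProbabilityMeasure P]
    (hP : Integrable id P) {f : ℝ → ℝ} (hf : LipschitzWith 1 f) (h0 : f 0 = 0) (v : E) :
    Integrable (fun z => f ⟪v, z⟫) P := by
  refine ((hP.norm.const_mul ‖v‖)).mono' ?_ (ae_of_all _ fun z => ?_)
  · exact (hf.continuous.comp (by fun_prop)).aestronglyMeasurable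
  · have := hf.norm_sub_le ⟪v, z⟫ 0
    simp only [h0, sub_zero, NNReal.coe_one, one_mul] at this
    exact this.trans (norm_inner_le_norm v z)

/-- Replacing one centred Lipschitz observation by twice the linear one does not decrease
exponential moments of a supremum. -/
lemma lintegral_exp_sup'_lipschitz_le {P : Measure E} [IsProbabilityMeasure P]
    (hP : Integrable id P) (hsymm : P.map (fun z => -z) = P) {f : ℝ → ℝ} (hf : LipschitzWith 1 f)
    (h0 : f 0 = 0) (V : Finset E) (hV : V.Nonempty) (a : E → ℝ) (l : ℝ) :
    ∫⁻ z, ENNReal.ofReal (Real.exp (V.sup' hV fun v =>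
        a v + l * (f ⟪v, z⟫ - ∫ z', f ⟪v, z'⟫ ∂P))) ∂P ≤
      ∫⁻ z, ENNReal.ofReal (Real.exp (V.sup' hV fun v => a v + 2 * l * ⟪v, z⟫)) ∂P := by
  have cont : ∀ g : E → E → ℝ, (∀ v, Continuous (g v)) →
      Measurable fun z => ENNReal.ofReal (Real.exp (V.sup' hV fun v => g v z)) := fun g hg =>
    (ENNReal.continuous_ofReal.comp (Real.continuous_exp.comp
      (Continuous.finset_sup'_apply hV fun v _ => hg v))).measurable
  have cf : ∀ v : E, Continuous fun z : E => f ⟪v, z⟫ := fun v =>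
    hf.continuous.comp (by fun_prop)
  have mA := cont (fun v z => a v + 2 * l * f ⟪v, z⟫) (fun v => continuous_const.add (continuous_const.mul (cf v)))
  have mB := cont (fun v z => a v - 2 * l * f ⟪v, z⟫) (fun v => continuous_const.sub (continuous_const.mul (cf v)))
  have mA' := cont (fun v z => a v + 2 * l * ⟪v, z⟫) (fun v => by fun_prop)
  have mB' := cont (fun v z => a v - 2 * l * ⟪v, z⟫) (fun v => by fun_prop)
  have jensen : ∀ z : E, ENNReal.ofReal (Real.exp (V.sup' hV fun v =>
        a v + l * (f ⟪v, z⟫ - ∫ z', f ⟪v, z'⟫ ∂P))) ≤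
      ∫⁻ z', ENNReal.ofReal (Real.exp (V.sup' hV fun v =>
        a v + l * (f ⟪v, z⟫ - f ⟪v, z'⟫))) ∂P := by
    intro z
    obtain ⟨v, hv, ev⟩ := V.exists_mem_eq_sup' hV fun v =>
      a v + l * (f ⟪v, z⟫ - ∫ z', f ⟪v, z'⟫ ∂P)
    have hi := integrable_lipschitz_inner hP hf h0 v
    have hi1 : Integrable (fun z' => f ⟪v, z⟫ - f ⟪v, z'⟫) P := (integrable_const _).sub hi
    have hi2 : Integrable (fun z' => l * (f ⟪v, z⟫ - f ⟪v, z'⟫)) P := hi1.const_mul l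
    have e : a v + l * (f ⟪v, z⟫ - ∫ z', f ⟪v, z'⟫ ∂P) =
        ∫ z', (a v + l * (f ⟪v, z⟫ - f ⟪v, z'⟫)) ∂P := by
      rw [integral_add (integrable_const _) hi2, integral_const_mul,
        integral_sub (integrable_const _) hi]
      simp
    rw [ev, e]
    refine (ofReal_exp_integral_le ((integrable_const _).add hi2)).trans
      (lintegral_mono fun z' => ?_)
    exact ENNReal.ofReal_le_ofReal (Real.exp_le_exp.2
      (Finset.le_sup' (fun v => a v + l * (f ⟪v, z⟫ - f ⟪v, z'⟫)) hv))
  -- Convexity decouples the observation from its independent copy, at the price of doubling the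
  -- weight `l`.
  have split : ∀ z z' : E, ENNReal.ofReal (Real.exp (V.sup' hV fun v =>
        a v + l * (f ⟪v, z⟫ - f ⟪v, z'⟫))) ≤
      ENNReal.ofReal (1 / 2) *
          ENNReal.ofReal (Real.exp (V.sup' hV fun v => a v + 2 * l * f ⟪v, z⟫)) +
        ENNReal.ofReal (1 / 2) *
          ENNReal.ofReal (Real.exp (V.sup' hV fun v => a v - 2 * l * f ⟪v, z'⟫)) := by
    intro z z'
    rw [← ENNReal.ofReal_mul (by norm_num), ← ENNReal.ofReal_mul (by norm_num),
      ← ENNReal.ofReal_add (by positivity) (by positivity)]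
    refine ENNReal.ofReal_le_ofReal ?_
    set x := V.sup' hV fun v => a v + 2 * l * f ⟪v, z⟫ with hx
    set y := V.sup' hV fun v => a v - 2 * l * f ⟪v, z'⟫ with hy
    have h1 : (V.sup' hV fun v => a v + l * (f ⟪v, z⟫ - f ⟪v, z'⟫)) ≤
        1 / 2 * x + 1 / 2 * y := by
      refine Finset.sup'_le _ _ fun v hv => ?_
      have h1 := Finset.le_sup' (fun v => a v + 2 * l * f ⟪v, z⟫) hv
      have h2 := Finset.le_sup' (fun v => a v - 2 * l * f ⟪v, z'⟫) hv
      rw [← hx] at h1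
      rw [← hy] at h2
      linarith
    have h2 := convexOn_exp.2 (Set.mem_univ x) (Set.mem_univ y)
      (by norm_num : (0 : ℝ) ≤ 1 / 2) (by norm_num : (0 : ℝ) ≤ 1 / 2) (by norm_num)
    simp only [smul_eq_mul] at h2
    exact (Real.exp_le_exp.2 h1).trans h2
  -- The pair of opposite signs plays the role of a Rademacher average; the symmetry of `P` later
  -- merges the two linear terms.
  have contr : ∀ z : E,
      ENNReal.ofReal (Real.exp (V.sup' hV fun v => a v + 2 * l * f ⟪v, z⟫)) +
        ENNReal.ofReal (Real.exp (V.sup' hV fun v => a v - 2 * l * f ⟪v, z⟫)) ≤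
      ENNReal.ofReal (Real.exp (V.sup' hV fun v => a v + 2 * l * ⟪v, z⟫)) +
        ENNReal.ofReal (Real.exp (V.sup' hV fun v => a v - 2 * l * ⟪v, z⟫)) := by
    intro z
    rw [← ENNReal.ofReal_add (by positivity) (by positivity),
      ← ENNReal.ofReal_add (by positivity) (by positivity)]
    refine ENNReal.ofReal_le_ofReal (exp_sup'_contraction V hV a (fun v => 2 * l * f ⟪v, z⟫)
      (fun v => 2 * l * ⟪v, z⟫) (fun v _ => ?_) fun v _ w _ => ?_)
    · have := hf.norm_sub_le ⟪v, z⟫ 0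
      simp only [h0, sub_zero, NNReal.coe_one, one_mul, Real.norm_eq_abs] at this
      rw [abs_mul, abs_mul (2 * l)]
      gcongr
    · have := hf.norm_sub_le ⟪v, z⟫ ⟪w, z⟫
      simp only [NNReal.coe_one, one_mul, Real.norm_eq_abs] at this
      rw [← mul_sub, ← mul_sub, abs_mul, abs_mul (2 * l)]
      gcongr
  have reflect : ∫⁻ z, ENNReal.ofReal (Real.exp (V.sup' hV fun v => a v - 2 * l * ⟪v, z⟫)) ∂P =
      ∫⁻ z, ENNReal.ofReal (Real.exp (V.sup' hV fun v => a v + 2 * l * ⟪v, z⟫)) ∂P := by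
    conv_rhs => rw [← hsymm]
    rw [lintegral_map mA' (by fun_prop)]
    simp [sub_eq_add_neg]
  have half : ∀ x : ℝ≥0∞, ENNReal.ofReal (1 / 2) * (x + x) = x := by
    intro x
    rw [← two_mul, ← mul_assoc, show (2 : ℝ≥0∞) = ENNReal.ofReal 2 by simp,
      ← ENNReal.ofReal_mul (by norm_num)]
    norm_num
  calc _ ≤ ∫⁻ z, ∫⁻ z', (ENNReal.ofReal (1 / 2) *
          ENNReal.ofReal (Real.exp (V.sup' hV fun v => a v + 2 * l * f ⟪v, z⟫)) +
        ENNReal.ofReal (1 / 2) *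
          ENNReal.ofReal (Real.exp (V.sup' hV fun v => a v - 2 * l * f ⟪v, z'⟫))) ∂P ∂P :=
        lintegral_mono fun z => (jensen z).trans (lintegral_mono fun z' => split z z')
    _ = ENNReal.ofReal (1 / 2) *
        ∫⁻ z, (ENNReal.ofReal (Real.exp (V.sup' hV fun v => a v + 2 * l * f ⟪v, z⟫)) +
          ENNReal.ofReal (Real.exp (V.sup' hV fun v => a v - 2 * l * f ⟪v, z⟫))) ∂P := by
        simp_rw [lintegral_add_left measurable_const]
        rw [lintegral_add_right _ measurable_const, lintegral_add_left mA, mul_add]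
        simp only [lintegral_const, measure_univ, mul_one]
        rw [lintegral_const_mul _ mA, lintegral_const_mul _ mB]
    _ ≤ ENNReal.ofReal (1 / 2) *
        ∫⁻ z, (ENNReal.ofReal (Real.exp (V.sup' hV fun v => a v + 2 * l * ⟪v, z⟫)) +
          ENNReal.ofReal (Real.exp (V.sup' hV fun v => a v - 2 * l * ⟪v, z⟫))) ∂P := by
        exact mul_le_mul' le_rfl (lintegral_mono contr)
    _ = _ := by rw [lintegral_add_left mA', reflect, half]

end Contraction

lemma lintegral_pi_fin_succ {X : Type*} [MeasurableSpace X] {P : Measure X} [SigmaFinite P]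
    {n : ℕ} {F : (Fin (n + 1) → X) → ℝ≥0∞} (hF : Measurable F) :
    ∫⁻ z, F z ∂(Measure.pi fun _ => P) =
      ∫⁻ x, ∫⁻ z, F (Fin.cons x z) ∂(Measure.pi fun _ : Fin n => P) ∂P := by
  have mp := (measurePreserving_piFinSuccAbove (fun _ : Fin (n + 1) => P) 0).symm
  rw [← mp.lintegral_comp hF, lintegral_prod (fun p => F _) (hF.comp mp.measurable).aemeasurable]
  simp [MeasurableEquiv.piFinSuccAbove, Fin.insertNthEquiv, Fin.insertNth_zero']

/-! ### Contraction for samples of arbitrary size -/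

section Tensorization

variable {E : Type*} [NormedAddCommGroup E] [InnerProductSpace ℝ E] [FiniteDimensional ℝ E]
  [MeasurableSpace E] [BorelSpace E]

/-- The arbitrary offset `a` drives the induction: it absorbs the first observation while the others
are linearized, and then, after Tonelli, the linearized ones while the first is treated. -/
lemma lintegral_pi_exp_sup'_lipschitz_le {P : Measure E} [IsProbabilityMeasure P]
    (hP : Integrable id P) (hsymm : P.map (fun z => -z) = P) {f : ℝ → ℝ} (hf : LipschitzWith 1 f)
    (h0 : f 0 = 0) (V : Finset E) (hV : V.Nonempty) (l : ℝ) (n : ℕ) (a : E → ℝ) :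
    ∫⁻ z, ENNReal.ofReal (Real.exp (V.sup' hV fun v =>
        a v + l * ∑ i, (f ⟪v, z i⟫ - ∫ z', f ⟪v, z'⟫ ∂P))) ∂(Measure.pi fun _ : Fin n => P) ≤
      ∫⁻ z, ENNReal.ofReal (Real.exp (V.sup' hV fun v => a v + 2 * l * ∑ i, ⟪v, z i⟫))
        ∂(Measure.pi fun _ : Fin n => P) := by
  induction n generalizing a with
  | zero => simp
  | succ n ih =>
    have cont : ∀ {Y : Type _} [TopologicalSpace Y] [MeasurableSpace Y] [OpensMeasurableSpace Y]
        (g : E → Y → ℝ), (∀ v, Continuous (g v)) →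
        Measurable fun z => ENNReal.ofReal (Real.exp (V.sup' hV fun v => g v z)) :=
      fun g hg => (ENNReal.continuous_ofReal.comp (Real.continuous_exp.comp
        (Continuous.finset_sup'_apply hV fun v _ => hg v))).measurable
    have hfc := hf.continuous
    rw [lintegral_pi_fin_succ (cont _ fun v => by fun_prop),
      lintegral_pi_fin_succ (cont _ fun v => by fun_prop)]
    simp only [Fin.sum_univ_succ, Fin.cons_zero, Fin.cons_succ, mul_add, ← add_assoc]
    calc _ ≤ ∫⁻ x, ∫⁻ z : Fin n → E, ENNReal.ofReal (Real.exp (V.sup' hV fun v =>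
          a v + l * (f ⟪v, x⟫ - ∫ z', f ⟪v, z'⟫ ∂P) + 2 * l * ∑ i, ⟪v, z i⟫))
            ∂(Measure.pi fun _ : Fin n => P) ∂P :=
          lintegral_mono fun x => ih fun v => a v + l * (f ⟪v, x⟫ - ∫ z', f ⟪v, z'⟫ ∂P)
      _ = ∫⁻ z : Fin n → E, ∫⁻ x, ENNReal.ofReal (Real.exp (V.sup' hV fun v =>
          a v + l * (f ⟪v, x⟫ - ∫ z', f ⟪v, z'⟫ ∂P) + 2 * l * ∑ i, ⟪v, z i⟫)) ∂P
            ∂(Measure.pi fun _ : Fin n => P) := by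
          refine lintegral_lintegral_swap (Measurable.aemeasurable ?_)
          exact cont (fun v (p : E × (Fin n → E)) =>
            a v + l * (f ⟪v, p.1⟫ - ∫ z', f ⟪v, z'⟫ ∂P) + 2 * l * ∑ i, ⟪v, p.2 i⟫)
            fun v => by fun_prop
      _ ≤ ∫⁻ z : Fin n → E, ∫⁻ x, ENNReal.ofReal (Real.exp (V.sup' hV fun v =>
          a v + 2 * l * ⟪v, x⟫ + 2 * l * ∑ i, ⟪v, z i⟫)) ∂P
            ∂(Measure.pi fun _ : Fin n => P) := by
          refine lintegral_mono fun z => ?_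
          have := lintegral_exp_sup'_lipschitz_le hP hsymm hf h0 V hV
            (fun v => a v + 2 * l * ∑ i, ⟪v, z i⟫) l
          simpa only [add_right_comm] using this
      _ = _ := by
          refine (lintegral_lintegral_swap (Measurable.aemeasurable ?_)).symm
          exact cont (fun v (p : E × (Fin n → E)) =>
            a v + 2 * l * ⟪v, p.1⟫ + 2 * l * ∑ i, ⟪v, p.2 i⟫) fun v => by fun_prop

end Tensorization

/-! ### Exponential moments of Gaussian norms -/

section GaussianMoments

lemma integrable_exp_sq_div_four_gaussianReal :
    Integrable (fun x : ℝ => Real.exp (x ^ 2 / 4)) (gaussianReal 0 1) ∧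
      ∫ x, Real.exp (x ^ 2 / 4) ∂(gaussianReal 0 1) = √2 := by
  have e : ∀ x : ℝ, gaussianPDFReal 0 1 x * Real.exp (x ^ 2 / 4) =
      (√(2 * Real.pi))⁻¹ * Real.exp (-(1 / 4) * x ^ 2) := by
    intro x
    simp only [gaussianPDFReal, NNReal.coe_one, mul_one, sub_zero]
    rw [mul_assoc, ← Real.exp_add]
    ring_nf
  constructor
  · rw [gaussianReal_of_var_ne_zero 0 one_ne_zero, gaussianPDF_def]
    have h := integrable_withDensity_iff_integrable_smul₀' (μ := volume)
      (f := fun x => ENNReal.ofReal (gaussianPDFReal 0 1 x))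
      (g := fun x : ℝ => Real.exp (x ^ 2 / 4))
      (measurable_gaussianPDFReal 0 1).ennreal_ofReal.aemeasurable (by simp)
    rw [h]
    simp only [ENNReal.toReal_ofReal (gaussianPDFReal_nonneg 0 1 _), smul_eq_mul, e]
    exact (integrable_exp_neg_mul_sq (by norm_num)).const_mul _
  · rw [integral_gaussianReal_eq_integral_smul one_ne_zero]
    simp only [smul_eq_mul, e]
    rw [integral_const_mul, integral_gaussian, ← Real.sqrt_inv, ← Real.sqrt_mul (by positivity)]
    congr 1
    field_simp
    norm_num

lemma lintegral_exp_norm_sq_stdGaussian_le (d : ℕ) :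
    ∫⁻ z, ENNReal.ofReal (Real.exp (‖z‖ ^ 2 / 4)) ∂(stdGaussian (EuclideanSpace ℝ (Fin d))) ≤
      ENNReal.ofReal (Real.exp (d / 2)) := by
  rw [← map_pi_eq_stdGaussian, lintegral_map (by fun_prop) (by fun_prop)]
  have e : ∀ x : Fin d → ℝ, Real.exp (‖(WithLp.toLp 2 x : EuclideanSpace ℝ (Fin d))‖ ^ 2 / 4) =
      ∏ i, Real.exp (x i ^ 2 / 4) := by
    intro x
    rw [← Real.exp_sum, EuclideanSpace.real_norm_sq_eq, Finset.sum_div]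
  simp_rw [e]
  rw [← ofReal_integral_eq_lintegral_ofReal
    (Integrable.fintype_prod fun _ => integrable_exp_sq_div_four_gaussianReal.1)
    (ae_of_all _ fun x => Finset.prod_nonneg fun i _ => (Real.exp_pos _).le),
    integral_fintype_prod_eq_prod (f := fun (_ : Fin d) (x : ℝ) => Real.exp (x ^ 2 / 4))]
  refine ENNReal.ofReal_le_ofReal ?_
  rw [integrable_exp_sq_div_four_gaussianReal.2, Finset.prod_const, Finset.card_univ,
    Fintype.card_fin]
  have : √2 ≤ Real.exp (1 / 2) := by
    rw [Real.sqrt_le_left (Real.exp_pos _).le, ← Real.exp_nat_mul]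
    have := Real.add_one_le_exp (1 : ℝ)
    norm_num at this ⊢
    linarith
  calc √2 ^ d ≤ Real.exp (1 / 2) ^ d := by gcongr
    _ = Real.exp (d / 2) := by rw [← Real.exp_nat_mul]; ring_nf

lemma map_sum_pi_stdGaussian (d : ℕ) {n : ℕ} (hn : 0 < n) :
    (Measure.pi fun _ : Fin n => stdGaussian (EuclideanSpace ℝ (Fin d))).map
        (fun z => (√n)⁻¹ • ∑ i, z i) = stdGaussian (EuclideanSpace ℝ (Fin d)) := by
  apply Measure.ext_of_charFun
  ext t
  rw [charFun_apply, integral_map (Measurable.aemeasurable (by fun_prop))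
    (Measurable.aestronglyMeasurable (by fun_prop))]
  have e : ∀ z : Fin n → EuclideanSpace ℝ (Fin d),
      Complex.exp ((⟪(√n)⁻¹ • ∑ i, z i, t⟫ : ℝ) * Complex.I) =
        ∏ i, Complex.exp ((⟪z i, (√n)⁻¹ • t⟫ : ℝ) * Complex.I) := by
    intro z
    rw [← Complex.exp_sum, ← Finset.sum_mul, ← Complex.ofReal_sum, real_inner_smul_left,
      sum_inner, Finset.mul_sum]
    simp_rw [real_inner_smul_right]
  simp_rw [e]
  rw [integral_fintype_prod_eq_prod (f := fun (_ : Fin n) (x : EuclideanSpace ℝ (Fin d)) =>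
    Complex.exp ((⟪x, (√n)⁻¹ • t⟫ : ℝ) * Complex.I))]
  simp_rw [← charFun_apply, charFun_stdGaussian]
  rw [Finset.prod_const, ← Complex.exp_nat_mul, norm_smul]
  congr 1
  have hn' : (n : ℝ) ≠ 0 := by positivity
  have h : (n : ℝ) * (-(‖(√n)⁻¹‖ * ‖t‖) ^ 2 / 2) = -‖t‖ ^ 2 / 2 := by
    rw [mul_pow, Real.norm_eq_abs, sq_abs, inv_pow, Real.sq_sqrt (by positivity)]
    field_simp
  rw [Finset.card_univ, Fintype.card_fin]
  exact_mod_cast congrArg (fun x : ℝ => (x : ℂ)) h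

/-- With `y` the norm of the sum, completing the square gives `2ly ≤ 4l²n + y²/(4n)`, and the sum
divided by `√n` is again standard Gaussian. -/
lemma lintegral_exp_norm_sum_stdGaussian_le (d : ℕ) {n : ℕ} (hn : 0 < n) (l : ℝ) :
    ∫⁻ z, ENNReal.ofReal (Real.exp (2 * l * ‖∑ i, z i‖))
        ∂(Measure.pi fun _ : Fin n => stdGaussian (EuclideanSpace ℝ (Fin d))) ≤
      ENNReal.ofReal (Real.exp (4 * l ^ 2 * n + d / 2)) := by
  have hn' : (0 : ℝ) < n := by positivity
  calc _ ≤ ∫⁻ z : Fin n → EuclideanSpace ℝ (Fin d), ENNReal.ofReal (Real.exp (4 * l ^ 2 * n)) *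
        ENNReal.ofReal (Real.exp (‖(√n)⁻¹ • ∑ i, z i‖ ^ 2 / 4))
          ∂(Measure.pi fun _ : Fin n => stdGaussian (EuclideanSpace ℝ (Fin d))) := by
        refine lintegral_mono fun z => ?_
        rw [← ENNReal.ofReal_mul (Real.exp_pos _).le, ← Real.exp_add]
        refine ENNReal.ofReal_le_ofReal (Real.exp_le_exp.2 ?_)
        rw [norm_smul, mul_pow, Real.norm_eq_abs, sq_abs, inv_pow, Real.sq_sqrt hn'.le]
        set y := ‖∑ i, z i‖
        have : 4 * l ^ 2 * n + (n : ℝ)⁻¹ * y ^ 2 / 4 - 2 * l * y =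
            (n : ℝ)⁻¹ * (2 * l * n - y / 2) ^ 2 := by
          field_simp
          ring
        have h2 : 0 ≤ (n : ℝ)⁻¹ * (2 * l * n - y / 2) ^ 2 := by positivity
        linarith
    _ = ENNReal.ofReal (Real.exp (4 * l ^ 2 * n)) *
        ∫⁻ z, ENNReal.ofReal (Real.exp (‖z‖ ^ 2 / 4))
          ∂(stdGaussian (EuclideanSpace ℝ (Fin d))) := by
        rw [lintegral_const_mul _ (by fun_prop), ← map_sum_pi_stdGaussian d hn,
          lintegral_map (by fun_prop) (by fun_prop), map_sum_pi_stdGaussian d hn]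
    _ ≤ _ := by
        rw [Real.exp_add, ENNReal.ofReal_mul (Real.exp_pos _).le]
        exact mul_le_mul' le_rfl (lintegral_exp_norm_sq_stdGaussian_le d)

end GaussianMoments

/-! ### Uniform deviations over the unit ball -/

section UniformLaw

variable {d n : ℕ} {f : ℝ → ℝ}

lemma map_neg_stdGaussian (d : ℕ) : (stdGaussian (EuclideanSpace ℝ (Fin d))).map (fun z => -z) =
    stdGaussian (EuclideanSpace ℝ (Fin d)) :=
  stdGaussian_map (LinearIsometryEquiv.neg ℝ)

lemma measure_exists_mem_finset_sum_ge_le (hn : 0 < n) (hf : LipschitzWith 1 f) (h0 : f 0 = 0)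
    (V : Finset (EuclideanSpace ℝ (Fin d))) (hV : V.Nonempty) (hV1 : ∀ v ∈ V, ‖v‖ ≤ 1)
    {t : ℝ} (ht : 0 ≤ t) :
    (Measure.pi fun _ : Fin n => stdGaussian (EuclideanSpace ℝ (Fin d)))
        {z | ∃ v ∈ V, n * t ≤ ∑ i, (f ⟪v, z i⟫ -
          ∫ z', f ⟪v, z'⟫ ∂(stdGaussian (EuclideanSpace ℝ (Fin d))))} ≤
      ENNReal.ofReal (Real.exp (d / 2 - n * t ^ 2 / 16)) := by
  set P := stdGaussian (EuclideanSpace ℝ (Fin d)) with hP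
  have hfc := hf.continuous
  -- This minimizes the Chernoff exponent `4l²n - lnt`.
  set l := t / 8 with hl
  have l0 : 0 ≤ l := by positivity
  set F : (Fin n → EuclideanSpace ℝ (Fin d)) → ℝ≥0∞ := fun z => ENNReal.ofReal (Real.exp
    (V.sup' hV fun v => 0 + l * ∑ i, (f ⟪v, z i⟫ - ∫ z', f ⟪v, z'⟫ ∂P))) with hF
  have mF : Measurable F := (ENNReal.continuous_ofReal.comp (Real.continuous_exp.comp
    (Continuous.finset_sup'_apply hV fun v _ => by fun_prop))).measurable
  have iF : ∫⁻ z, F z ∂(Measure.pi fun _ : Fin n => P) ≤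
      ENNReal.ofReal (Real.exp (4 * l ^ 2 * n + d / 2)) := by
    refine ((lintegral_pi_exp_sup'_lipschitz_le IsGaussian.integrable_id (map_neg_stdGaussian d)
      hf h0 V hV l n fun _ => 0).trans (lintegral_mono fun z => ?_)).trans
      (lintegral_exp_norm_sum_stdGaussian_le d hn l)
    refine ENNReal.ofReal_le_ofReal (Real.exp_le_exp.2 (Finset.sup'_le _ _ fun v hv => ?_))
    rw [zero_add, ← inner_sum]
    have h1 := real_inner_le_norm v (∑ i, z i)
    have h2 := mul_le_mul_of_nonneg_right (hV1 v hv) (norm_nonneg (∑ i, z i))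
    exact mul_le_mul_of_nonneg_left (by linarith) (by positivity)
  have sub : {z : Fin n → EuclideanSpace ℝ (Fin d) | ∃ v ∈ V, n * t ≤ ∑ i, (f ⟪v, z i⟫ -
      ∫ z', f ⟪v, z'⟫ ∂P)} ⊆ {z | ENNReal.ofReal (Real.exp (l * (n * t))) ≤ F z} := by
    rintro z ⟨v, hv, h⟩
    refine ENNReal.ofReal_le_ofReal (Real.exp_le_exp.2 ?_)
    refine le_trans ?_ (Finset.le_sup' _ hv)
    rw [zero_add]
    exact mul_le_mul_of_nonneg_left h l0
  refine (measure_mono sub).trans ((meas_ge_le_lintegral_div mF.aemeasurable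
    (by simp [Real.exp_pos]) ENNReal.ofReal_ne_top).trans ?_)
  refine (ENNReal.div_le_div_right iF _).trans (le_of_eq ?_)
  rw [← ENNReal.ofReal_div_of_pos (Real.exp_pos _), ← Real.exp_sub, hl]
  congr 2
  ring

/-- A uniform law of large numbers for a Lipschitz function of the projections of a standard
Gaussian sample, with sub-Gaussian deviations and no logarithmic loss in the dimension. -/
lemma measure_exists_sum_gt_le (hn : 0 < n) (hf : LipschitzWith 1 f) (h0 : f 0 = 0)
    {t : ℝ} (ht : 0 ≤ t) :
    (Measure.pi fun _ : Fin n => stdGaussian (EuclideanSpace ℝ (Fin d)))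
        {z | ∃ v : EuclideanSpace ℝ (Fin d), ‖v‖ ≤ 1 ∧ n * t < ∑ i, (f ⟪v, z i⟫ -
          ∫ z', f ⟪v, z'⟫ ∂(stdGaussian (EuclideanSpace ℝ (Fin d))))} ≤
      ENNReal.ofReal (Real.exp (d / 2 - n * t ^ 2 / 16)) := by
  classical
  set P := stdGaussian (EuclideanSpace ℝ (Fin d)) with hP
  let B := Metric.closedBall (0 : EuclideanSpace ℝ (Fin d)) 1
  have : Nonempty B := ⟨⟨0, by simp [B]⟩⟩
  have hB : ∀ v : B, ‖(v : EuclideanSpace ℝ (Fin d))‖ ≤ 1 := fun v =>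
    mem_closedBall_zero_iff.1 v.2
  have hfc := hf.continuous
  let V : ℕ → Finset (EuclideanSpace ℝ (Fin d)) := fun k =>
    (Finset.range (k + 1)).image fun j => (TopologicalSpace.denseSeq B j : EuclideanSpace ℝ (Fin d))
  let S : ℕ → Set (Fin n → EuclideanSpace ℝ (Fin d)) := fun k =>
    {z | ∃ v ∈ V k, n * t ≤ ∑ i, (f ⟪v, z i⟫ - ∫ z', f ⟪v, z'⟫ ∂P)}
  have hS : Monotone S := by
    rintro j k hjk z ⟨v, hv, h⟩
    exact ⟨v, Finset.image_subset_image (Finset.range_mono (by omega)) hv, h⟩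
  have cm : Continuous fun v : B => ∫ z', f ⟪(v : EuclideanSpace ℝ (Fin d)), z'⟫ ∂P := by
    refine continuous_of_dominated (bound := fun z => ‖z‖) (fun v => ?_) (fun v => ?_) ?_ ?_
    · exact (hfc.comp (by fun_prop)).aestronglyMeasurable
    · refine ae_of_all _ fun z => ?_
      have := hf.norm_sub_le ⟪(v : EuclideanSpace ℝ (Fin d)), z⟫ 0
      simp only [h0, sub_zero, NNReal.coe_one, one_mul] at this
      refine (this.trans (norm_inner_le_norm _ z)).trans ?_
      exact mul_le_of_le_one_left (norm_nonneg _) (hB v)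
    · exact IsGaussian.integrable_id.norm
    · exact ae_of_all _ fun z => by fun_prop
  have sub : {z : Fin n → EuclideanSpace ℝ (Fin d) | ∃ v : EuclideanSpace ℝ (Fin d), ‖v‖ ≤ 1 ∧
      n * t < ∑ i, (f ⟪v, z i⟫ - ∫ z', f ⟪v, z'⟫ ∂P)} ⊆ ⋃ k, S k := by
    -- The strict inequality defines an open set of directions, so some term of the dense sequence
    -- already violates the bound; the finite case then applies with a bound independent of the size
    -- of `V k`.
    rintro z ⟨v, hv, h⟩
    have ho : IsOpen {w : B | n * t < ∑ i, (f ⟪(w : EuclideanSpace ℝ (Fin d)), z i⟫ -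
        ∫ z', f ⟪(w : EuclideanSpace ℝ (Fin d)), z'⟫ ∂P)} :=
      isOpen_lt continuous_const (by fun_prop)
    obtain ⟨w, hw, ⟨k, rfl⟩⟩ := (TopologicalSpace.denseRange_denseSeq B).inter_open_nonempty _ ho
      ⟨⟨v, by simpa [B] using hv⟩, h⟩
    exact Set.mem_iUnion.2 ⟨k, _, Finset.mem_image.2 ⟨k, by simp, rfl⟩, le_of_lt hw⟩
  refine (measure_mono sub).trans ?_
  rw [hS.measure_iUnion]
  refine iSup_le fun k => measure_exists_mem_finset_sum_ge_le hn hf h0 (V k) (by simp [V])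
    (fun v hv => ?_) ht
  obtain ⟨j, -, rfl⟩ := Finset.mem_image.1 hv
  exact hB _

end UniformLaw

/-! ### The score -/

/-- Truncation of a real number to `[-1, 1]`. -/
noncomputable def clamp (x : ℝ) : ℝ := max (-1) (min x 1)

lemma lipschitzWith_clamp : LipschitzWith 1 clamp :=
  (LipschitzWith.id.min_const 1).const_max (-1)

lemma clamp_zero : clamp 0 = 0 := by norm_num [clamp]

lemma clamp_neg (x : ℝ) : clamp (-x) = -clamp x := by
  unfold clamp
  rcases le_total x 1 with h | h <;> rcases le_total (-1) x with h' | h' <;>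
    simp [min_def, max_def] <;> split_ifs <;> linarith

lemma neg_one_le_clamp (x : ℝ) : -1 ≤ clamp x := le_max_left _ _

lemma clamp_le_one (x : ℝ) : clamp x ≤ 1 := max_le (by norm_num) (min_le_right _ _)

/-- For `|x| ≤ 1/2` both points lie where `clamp` is the identity; beyond that the factor `1 - 2|x|`
is nonpositive and monotonicity suffices. The decrease is linear in `|x|`, so only first absolute
moments of the sample will be needed. -/
lemma clamp_sub_le {x s : ℝ} (hs : 0 ≤ s) (hs' : s ≤ 1 / 2) :
    clamp (x - s) ≤ clamp x - s * (1 - 2 * |x|) := by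
  rcases le_total |x| (1 / 2) with h | h
  · have h1 := abs_le.1 h
    have e1 : clamp x = x := by
      rw [clamp, min_eq_left (by linarith), max_eq_right (by linarith)]
    have e2 : clamp (x - s) = x - s := by
      rw [clamp, min_eq_left (by linarith), max_eq_right (by linarith)]
    rw [e1, e2]
    nlinarith [abs_nonneg x]
  · have h1 : clamp (x - s) ≤ clamp x :=
      max_le_max le_rfl (min_le_min (by linarith) le_rfl)
    nlinarith

lemma sub_le_clamp_sub {x s r : ℝ} (h : |s| ≤ r) : clamp x - r ≤ clamp (x - s) := by
  have := lipschitzWith_clamp.norm_sub_le x (x - s)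
  simp only [NNReal.coe_one, one_mul, Real.norm_eq_abs, sub_sub_cancel] at this
  linarith [(abs_le.1 this).2]

lemma lipschitzWith_min_abs : LipschitzWith 1 fun x : ℝ => min |x| 1 :=
  lipschitzWith_one_norm.min_const 1

lemma sub_le_min_abs_sub {x s r : ℝ} (h : |s| ≤ r) : min |x| 1 - r ≤ min |x - s| 1 := by
  have := lipschitzWith_min_abs.norm_sub_le x (x - s)
  simp only [NNReal.coe_one, one_mul, Real.norm_eq_abs, sub_sub_cancel] at this
  linarith [(abs_le.1 this).2]

/-- The mean of `min |g| 1` for a standard normal `g`. -/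
noncomputable def truncMean : ℝ := ∫ x, min |x| 1 ∂(gaussianReal 0 1)

lemma integrable_min_abs : Integrable (fun x : ℝ => min |x| 1) (gaussianReal 0 1) :=
  Integrable.of_bound (by fun_prop) 1 (ae_of_all _ fun x => by
    rw [Real.norm_eq_abs, abs_of_nonneg (le_min (abs_nonneg x) zero_le_one)]
    exact min_le_right _ _)

lemma truncMean_le_one : truncMean ≤ 1 := by
  have := integral_mono integrable_min_abs (integrable_const (1 : ℝ)) fun x => min_le_right |x| 1
  simpa [truncMean] using this

lemma truncMean_pos : 0 < truncMean := by
  rw [truncMean, integral_pos_iff_support_of_nonneg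
    (fun x => le_min (abs_nonneg x) zero_le_one) integrable_min_abs]
  have : Function.support (fun x : ℝ => min |x| 1) = {0}ᶜ := by
    ext x
    simp only [Function.mem_support, Set.mem_compl_iff, Set.mem_singleton_iff, not_iff_not]
    constructor
    · intro h
      rcases min_choice |x| 1 with h' | h' <;> rw [h'] at h
      · exact abs_eq_zero.1 h
      · exact absurd h one_ne_zero
    · rintro rfl; simp
  have := nullSingletonClass_gaussianReal (μ := 0) (v := 1) one_ne_zero
  rw [‹Function.support _ = _›, prob_compl_eq_one_sub (measurableSet_singleton 0), measure_singleton]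
  simp

/-! ### Means of the test functions under the standard Gaussian -/

section Means

variable {d : ℕ}

lemma integral_clamp_inner (v : EuclideanSpace ℝ (Fin d)) :
    ∫ z, clamp ⟪v, z⟫ ∂(stdGaussian (EuclideanSpace ℝ (Fin d))) = 0 := by
  have hc := lipschitzWith_clamp.continuous
  have h : ∫ z, clamp ⟪v, z⟫ ∂(stdGaussian (EuclideanSpace ℝ (Fin d))) =
      -∫ z, clamp ⟪v, z⟫ ∂(stdGaussian (EuclideanSpace ℝ (Fin d))) := by
    conv_lhs => rw [← map_neg_stdGaussian]
    have hcv : Continuous fun z : EuclideanSpace ℝ (Fin d) => clamp ⟪v, z⟫ :=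
      hc.comp (by fun_prop)
    rw [integral_map (by fun_prop) hcv.aestronglyMeasurable]
    simp_rw [inner_neg_right, clamp_neg]
    rw [integral_neg]
  linarith

lemma map_inner_stdGaussian (v : EuclideanSpace ℝ (Fin d)) :
    (stdGaussian (EuclideanSpace ℝ (Fin d))).map (fun z => ⟪v, z⟫) =
      gaussianReal 0 (‖v‖ ^ 2).toNNReal := by
  have h := IsGaussian.map_eq_gaussianReal (μ := stdGaussian (EuclideanSpace ℝ (Fin d)))
    (innerSL ℝ v)
  rw [integral_strongDual_stdGaussian, variance_dual_stdGaussian, innerSL_apply_norm] at h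
  exact h

lemma integral_min_abs_inner {v : EuclideanSpace ℝ (Fin d)} (hv : ‖v‖ = 1) :
    ∫ z, min |⟪v, z⟫| 1 ∂(stdGaussian (EuclideanSpace ℝ (Fin d))) = truncMean := by
  have h := map_inner_stdGaussian v
  rw [hv] at h
  norm_num at h
  rw [truncMean, ← h, integral_map (by fun_prop) (by fun_prop)]

/-- Follows from `|x| ≤ x²/(2σ) + σ/2` with `σ = ‖v‖`, since `⟪v, z⟫` has second moment `σ²`. -/
lemma integral_abs_inner_le (v : EuclideanSpace ℝ (Fin d)) :
    ∫ z, |⟪v, z⟫| ∂(stdGaussian (EuclideanSpace ℝ (Fin d))) ≤ ‖v‖ := by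
  rcases eq_or_ne v 0 with rfl | hv
  · simp
  have hv0 : 0 < ‖v‖ := norm_pos_iff.2 hv
  set P := stdGaussian (EuclideanSpace ℝ (Fin d))
  have m2 : MemLp (fun z => ⟪v, z⟫) 2 P :=
    (innerSL ℝ v).comp_memLp' (IsGaussian.memLp_two_id (μ := P))
  have i2 : Integrable (fun z => ⟪v, z⟫ ^ 2) P := m2.integrable_sq
  have e2 : ∫ z, ⟪v, z⟫ ^ 2 ∂P = ‖v‖ ^ 2 := by
    have h := variance_dual_stdGaussian (E := EuclideanSpace ℝ (Fin d)) (innerSL ℝ v)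
    rw [variance_of_integral_eq_zero (by fun_prop) (integral_strongDual_stdGaussian _),
      innerSL_apply_norm] at h
    exact h
  have i1 : Integrable (fun z => |⟪v, z⟫|) P := (m2.integrable (by norm_num)).abs
  calc ∫ z, |⟪v, z⟫| ∂P ≤ ∫ z, (⟪v, z⟫ ^ 2 / (2 * ‖v‖) + ‖v‖ / 2) ∂P := by
        refine integral_mono i1 ((i2.div_const _).add (integrable_const _)) fun z => ?_
        have e : ⟪v, z⟫ ^ 2 / (2 * ‖v‖) + ‖v‖ / 2 - |⟪v, z⟫| =
            (|⟪v, z⟫| - ‖v‖) ^ 2 / (2 * ‖v‖) := by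
          rw [← sq_abs ⟪v, z⟫]
          field_simp
          ring
        have : 0 ≤ (|⟪v, z⟫| - ‖v‖) ^ 2 / (2 * ‖v‖) := by positivity
        show |⟪v, z⟫| ≤ _
        linarith
    _ = ‖v‖ := by
        rw [integral_add (i2.div_const _) (integrable_const _), integral_div, e2]
        simp
        field_simp
        norm_num

end Means

/-! ### Sensitivity, equivariance and accuracy of the score -/

section Score

variable {E : Type*} [NormedAddCommGroup E] [InnerProductSpace ℝ E] {n : ℕ}

/-- The value of the test with direction (and scale) `v` at the candidate `t`: a smoothed count of
the sample points on the positive side of `t`, with a penalty once `v` is too large compared with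
the spread of the sample. -/
noncomputable def testValue (X : Fin n → E) (t v : E) : ℝ :=
  ∑ i, clamp ⟪v, X i - t⟫ +
    4 / truncMean * max 0 (∑ i, min |⟪v, X i - t⟫| 1 - n * (truncMean / 4))

/-- A smoothed Tukey depth: the least value over all tests. -/
noncomputable def score (X : Fin n → E) (t : E) : ℝ := ⨅ v, testValue X t v

/-- Bound on the change of the score when one data point is replaced. -/
noncomputable def scoreSensitivity : ℝ := 2 + 4 / truncMean

lemma scoreSensitivity_pos : 0 < scoreSensitivity := by
  have := truncMean_pos
  unfold scoreSensitivity
  positivity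

lemma neg_card_le_sum_clamp (x : Fin n → ℝ) : -(n : ℝ) ≤ ∑ i, clamp (x i) := by
  have := Finset.sum_le_sum fun i (_ : i ∈ Finset.univ) => neg_one_le_clamp (x i)
  simpa using this

lemma penalty_nonneg (x : ℝ) : 0 ≤ 4 / truncMean * max 0 x :=
  mul_nonneg (div_nonneg (by norm_num) truncMean_pos.le) (le_max_left _ _)

lemma neg_card_le_testValue (X : Fin n → E) (t v : E) : -(n : ℝ) ≤ testValue X t v := by
  have h1 := neg_card_le_sum_clamp fun i => ⟪v, X i - t⟫
  have h2 := penalty_nonneg (∑ i, min |⟪v, X i - t⟫| 1 - n * (truncMean / 4))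
  unfold testValue
  linarith

lemma bddBelow_testValue (X : Fin n → E) (t : E) : BddBelow (Set.range (testValue X t)) :=
  ⟨-n, by rintro _ ⟨v, rfl⟩; exact neg_card_le_testValue X t v⟩

lemma score_le (X : Fin n → E) (t v : E) : score X t ≤ testValue X t v :=
  ciInf_le (bddBelow_testValue X t) v

lemma neg_card_le_score (X : Fin n → E) (t : E) : -(n : ℝ) ≤ score X t :=
  le_ciInf fun v => neg_card_le_testValue X t v

lemma score_nonpos (X : Fin n → E) (t : E) : score X t ≤ 0 := by
  refine (score_le X t 0).trans (le_of_eq ?_)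
  have : -((n : ℝ) * (truncMean / 4)) ≤ 0 := by
    have := truncMean_pos
    simp only [Left.neg_nonpos_iff]
    positivity
  simp [testValue, clamp_zero, max_eq_left this]

/-- One point moves the clamped sum by at most 2 and the truncated sum by at most 1, the latter
weighted by `4 / truncMean`. -/
lemma testValue_le_add_scoreSensitivity {X X' : Fin n → E} (j : Fin n)
    (h : ∀ i, i ≠ j → X i = X' i) (t v : E) :
    testValue X t v ≤ testValue X' t v + scoreSensitivity := by
  have swap : ∀ (f : E → ℝ) (c : ℝ), f (X j) ≤ f (X' j) + c →
      ∑ i, f (X i) ≤ ∑ i, f (X' i) + c := by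
    intro f c hc
    rw [← Finset.add_sum_erase _ _ (Finset.mem_univ j),
      ← Finset.add_sum_erase (a := j) _ (fun i => f (X' i)) (Finset.mem_univ j),
      Finset.sum_congr rfl fun i hi => by rw [h i (Finset.ne_of_mem_erase hi)]]
    linarith
  have h1 := swap (fun x => clamp ⟪v, x - t⟫) 2 (by
    have := clamp_le_one ⟪v, X j - t⟫
    have := neg_one_le_clamp ⟪v, X' j - t⟫
    linarith)
  have h2 := swap (fun x => min |⟪v, x - t⟫| 1) 1 (by
    have h3 : min |⟪v, X j - t⟫| 1 ≤ 1 := min_le_right _ _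
    have h4 : 0 ≤ min |⟪v, X' j - t⟫| 1 := le_min (abs_nonneg _) zero_le_one
    linarith)
  have h3 : max 0 (∑ i, min |⟪v, X i - t⟫| 1 - n * (truncMean / 4)) ≤
      max 0 (∑ i, min |⟪v, X' i - t⟫| 1 - n * (truncMean / 4)) + 1 :=
    max_le (by linarith [le_max_left 0 (∑ i, min |⟪v, X' i - t⟫| 1 - n * (truncMean / 4))])
      (by linarith [le_max_right 0 (∑ i, min |⟪v, X' i - t⟫| 1 - n * (truncMean / 4))])
  have h4 := mul_le_mul_of_nonneg_left h3 (div_nonneg (by norm_num) truncMean_pos.le :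
    0 ≤ 4 / truncMean)
  unfold testValue scoreSensitivity
  linarith

open Classical in
lemma score_le_add_scoreSensitivity {X X' : Fin n → E} (h : hammingDist X X' ≤ 1) (t : E) :
    score X t ≤ score X' t + scoreSensitivity := by
  have hs := scoreSensitivity_pos
  rcases Nat.le_one_iff_eq_zero_or_eq_one.1 h with h | h
  · rw [hammingDist_eq_zero.1 h]
    linarith
  · obtain ⟨j, hj⟩ := Finset.card_eq_one.1 h
    have hj' : ∀ i, i ≠ j → X i = X' i := by
      intro i hi
      by_contra hne
      have : i ∈ ({j} : Finset (Fin n)) := by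
        rw [← hj]
        exact Finset.mem_filter.2 ⟨Finset.mem_univ i, hne⟩
      exact hi (Finset.mem_singleton.1 this)
    rw [← sub_le_iff_le_add]
    refine le_ciInf fun v => ?_
    rw [sub_le_iff_le_add]
    exact (score_le X t v).trans (testValue_le_add_scoreSensitivity j hj' t v)

/-- The infimum is uncountable, but an infimum of continuous functions is upper semicontinuous. -/
lemma measurable_score [MeasurableSpace E] [BorelSpace E] [FiniteDimensional ℝ E] :
    Measurable fun p : (Fin n → E) × E => score p.1 p.2 := by
  refine UpperSemicontinuous.measurable (upperSemicontinuous_ciInf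
    (fun p => bddBelow_testValue p.1 p.2) fun v => Continuous.upperSemicontinuous ?_)
  have := lipschitzWith_clamp.continuous
  unfold testValue
  fun_prop

/-- Since `⟪v, A x⟫ = ⟪A v, x⟫`, the change of data is the substitution `v ↦ A v`, which permits
every test because `A` is surjective. -/
lemma score_affine {A : E →L[ℝ] E} (hA : ∀ x y, ⟪A x, y⟫ = ⟪x, A y⟫)
    (hsurj : Function.Surjective A) (m : E) (Z : Fin n → E) (u : E) :
    score (fun i => m + A (Z i)) (m + A u) = score Z u := by
  unfold score
  rw [← hsurj.iInf_comp (fun v => testValue Z u v)]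
  congr 1
  ext v
  unfold testValue
  simp_rw [add_sub_add_left_eq_sub, ← map_sub, ← hA]

/-- The properties of a standard Gaussian sample that make the score accurate. -/
def IsRegularSample (b : ℝ) (Z : Fin n → E) : Prop :=
  ∀ v : E, ‖v‖ ≤ 1 → |∑ i, clamp ⟪v, Z i⟫| ≤ n * b ∧ ∑ i, |⟪v, Z i⟫| ≤ n * (‖v‖ + b) ∧
    (‖v‖ = 1 → n * (truncMean - b) ≤ ∑ i, min |⟪v, Z i⟫| 1)

/-- Short tests are controlled by the regularity of the sample and the 1-Lipschitz property. Long
tests are compared with their unit rescaling, where the penalty already outweighs any clamped sum.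
-/
lemma le_score_of_norm_le {b r : ℝ} (hbr : b + r ≤ truncMean / 2) (hb : 0 ≤ b)
    (hr : 0 ≤ r) {Z : Fin n → E} (hZ : IsRegularSample b Z) {u : E} (hu : ‖u‖ ≤ r) :
    -(n * (b + r)) ≤ score Z u := by
  refine le_ciInf fun v => ?_
  unfold testValue
  rcases le_total ‖v‖ 1 with hv | hv
  · have h1 := (abs_le.1 (hZ v hv).1).1
    have h2 := penalty_nonneg (∑ i, min |⟪v, Z i - u⟫| 1 - n * (truncMean / 4))
    have hs : |⟪v, u⟫| ≤ r := (abs_real_inner_le_norm v u).trans (by nlinarith [norm_nonneg u])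
    have h3 := Finset.sum_le_sum fun i (_ : i ∈ Finset.univ) =>
      sub_le_clamp_sub (x := ⟪v, Z i⟫) hs
    simp only [Finset.sum_sub_distrib, Finset.sum_const, Finset.card_univ, Fintype.card_fin,
      nsmul_eq_mul] at h3
    simp only [inner_sub_right] at h2 ⊢
    linarith
  · have hv0 : 0 < ‖v‖ := by linarith
    set w := ‖v‖⁻¹ • v with hw
    have hw1 : ‖w‖ = 1 := by
      rw [hw, norm_smul, norm_inv, norm_norm, inv_mul_cancel₀ hv0.ne']
    have h1 := (hZ w hw1.le).2.2 hw1
    have hs : |⟪w, u⟫| ≤ r := (abs_real_inner_le_norm w u).trans (by rw [hw1]; linarith)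
    have h3 := Finset.sum_le_sum fun i (_ : i ∈ Finset.univ) =>
      sub_le_min_abs_sub (x := ⟪w, Z i⟫) hs
    simp only [Finset.sum_sub_distrib, Finset.sum_const, Finset.card_univ, Fintype.card_fin,
      nsmul_eq_mul] at h3
    have h4 : ∀ i, min |⟪w, Z i⟫ - ⟪w, u⟫| 1 ≤ min |⟪v, Z i - u⟫| 1 := by
      intro i
      refine min_le_min ?_ le_rfl
      rw [← inner_sub_right, hw, real_inner_smul_left, abs_mul, abs_inv, abs_norm]
      exact mul_le_of_le_one_left (abs_nonneg _) (inv_le_one_of_one_le₀ hv)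
    have h5 := Finset.sum_le_sum fun i (_ : i ∈ Finset.univ) => h4 i
    have hn : (0 : ℝ) ≤ n := Nat.cast_nonneg n
    have hc := truncMean_pos
    -- The truncated sum is at least `n * truncMean / 2`, twice the threshold. With weight `4 /
    -- truncMean` the excess yields a penalty of at least `n`, against a clamped sum of at least
    -- `-n`.
    have h6 : (n : ℝ) * (truncMean / 4) ≤
        max 0 (∑ i, min |⟪v, Z i - u⟫| 1 - n * (truncMean / 4)) :=
      le_max_of_le_right (by nlinarith)
    have h7 := mul_le_mul_of_nonneg_left h6 (div_nonneg (by norm_num) hc.le :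
      0 ≤ 4 / truncMean)
    have h8 : 4 / truncMean * (n * (truncMean / 4)) = n := by field_simp
    have h9 := neg_card_le_sum_clamp fun i => ⟪v, Z i - u⟫
    have h10 : 0 ≤ n * (b + r) := by positivity
    linarith

lemma score_le_of_le_norm {b α : ℝ} (hb : b ≤ truncMean / 12) (hα : 0 < α)
    (hα1 : α ≤ 1) {Z : Fin n → E} (hZ : IsRegularSample b Z) {u : E} (hu : α ≤ ‖u‖) :
    score Z u ≤ n * (b - truncMean / 12 * α / 4) := by
  have hc := truncMean_pos
  have hc1 := truncMean_le_one
  set l := truncMean / 12 with hl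
  have hn : (0 : ℝ) ≤ n := Nat.cast_nonneg n
  have hu0 : 0 < ‖u‖ := by linarith
  -- A test along `u` whose shift `⟪v, u⟫ = l‖u‖/(1 + ‖u‖)` stays below `l` however far `u` is, yet
  -- is at least `lα/2`.
  set v : E := (l / (‖u‖ * (1 + ‖u‖))) • u with hv
  set s := l * ‖u‖ / (1 + ‖u‖) with hs
  have hvu : ⟪v, u⟫ = s := by
    rw [hv, real_inner_smul_left, real_inner_self_eq_norm_sq, hs]
    field_simp
  have hvn : ‖v‖ ≤ l := by
    rw [hv, norm_smul, Real.norm_eq_abs, abs_of_nonneg (by positivity), div_mul_eq_mul_div,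
      div_le_iff₀ (by positivity)]
    have : 0 < l := by positivity
    nlinarith [mul_pos this hu0, mul_pos (mul_pos this hu0) hu0]
  have hl0 : 0 < l := by positivity
  have hsl : s ≤ l := by
    rw [hs, div_le_iff₀ (by positivity)]
    nlinarith
  have hs0 : l * α / 2 ≤ s := by
    rw [hs, le_div_iff₀ (by positivity)]
    have : α * (1 + ‖u‖) ≤ 2 * ‖u‖ := by nlinarith
    nlinarith
  have hspos : 0 ≤ s := le_trans (by positivity) hs0
  obtain ⟨h1, h2, -⟩ := hZ v (by linarith)
  have h2' : ∑ i, |⟪v, Z i⟫| ≤ n * (2 * l) := h2.trans (by gcongr; linarith)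
  refine (score_le Z u v).trans ?_
  -- The penalty is off: the sample contributes at most `2l` per point and the shift at most `l`,
  -- and `3l` is exactly the threshold `truncMean / 4`.
  have p1 : ∑ i, min |⟪v, Z i - u⟫| 1 - n * (truncMean / 4) ≤ 0 := by
    have : ∀ i, min |⟪v, Z i - u⟫| 1 ≤ |⟪v, Z i⟫| + s := by
      intro i
      refine (min_le_left _ _).trans ?_
      rw [inner_sub_right, hvu]
      exact (abs_sub _ _).trans (by rw [abs_of_nonneg hspos])
    have h := Finset.sum_le_sum fun i (_ : i ∈ Finset.univ) => this i
    simp only [Finset.sum_add_distrib, Finset.sum_const, Finset.card_univ, Fintype.card_fin,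
      nsmul_eq_mul] at h
    have : (n : ℝ) * s ≤ n * l := by gcongr
    have : (n : ℝ) * (truncMean / 4) = n * (3 * l) := by rw [hl]; ring
    linarith
  have p2 : ∑ i, clamp ⟪v, Z i - u⟫ ≤ ∑ i, clamp ⟪v, Z i⟫ - s * (n - 2 * ∑ i, |⟪v, Z i⟫|) := by
    have h := Finset.sum_le_sum fun i (_ : i ∈ Finset.univ) =>
      clamp_sub_le (x := ⟪v, Z i⟫) hspos (by linarith)
    simp only [Finset.sum_sub_distrib, ← Finset.mul_sum, Finset.sum_const, Finset.card_univ,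
      Fintype.card_fin, nsmul_eq_mul, mul_one] at h
    simpa only [inner_sub_right, hvu] using h
  have p3 : (n : ℝ) / 2 ≤ n - 2 * ∑ i, |⟪v, Z i⟫| := by nlinarith
  have p4 : l * α / 2 * (n / 2) ≤ s * (n - 2 * ∑ i, |⟪v, Z i⟫|) :=
    mul_le_mul hs0 p3 (by positivity) hspos
  have p5 := (abs_le.1 h1).2
  rw [testValue, max_eq_left p1, mul_zero, add_zero]
  linarith

end Score

/-- Three uses of the uniform law, with `clamp`, `|x|` and `-min |x| 1`. Oddness of `clamp` turns
its one-sided bound into a two-sided one by passing to `-v`. -/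
lemma measure_not_isRegularSample_le {d n : ℕ} (hn : 0 < n) {b : ℝ} (hb : 0 ≤ b) :
    (Measure.pi fun _ : Fin n => stdGaussian (EuclideanSpace ℝ (Fin d)))
        {Z | ¬ IsRegularSample b Z} ≤
      3 * ENNReal.ofReal (Real.exp (d / 2 - n * b ^ 2 / 16)) := by
  have t1 := measure_exists_sum_gt_le (d := d) hn lipschitzWith_clamp clamp_zero hb
  have t2 := measure_exists_sum_gt_le (d := d) hn
    (lipschitzWith_one_norm : LipschitzWith 1 fun x : ℝ => ‖x‖) norm_zero hb
  have t3 := measure_exists_sum_gt_le (d := d) hn (lipschitzWith_min_abs.neg) (by simp) hb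
  refine (measure_mono ?_).trans ((measure_union_le _ _).trans (add_le_add
    ((measure_union_le _ _).trans (add_le_add t1 t2)) t3) |>.trans (le_of_eq (by ring)))
  intro Z hZ
  by_contra hnot
  simp only [Set.mem_union, Set.mem_ofPred_eq, not_or, not_exists, not_and, not_lt] at hnot
  obtain ⟨⟨c1, c2⟩, c3⟩ := hnot
  refine hZ fun v hv => ⟨abs_le.2 ⟨?_, ?_⟩, ?_, fun hv1 => ?_⟩
  · have := c1 (-v) (by rwa [norm_neg])
    simp only [inner_neg_left, clamp_neg, integral_neg, integral_clamp_inner, neg_zero, sub_zero,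
      Finset.sum_neg_distrib] at this
    linarith
  · have := c1 v hv
    simpa only [integral_clamp_inner, sub_zero] using this
  · have := c2 v hv
    simp only [Real.norm_eq_abs, Finset.sum_sub_distrib, Finset.sum_const, Finset.card_univ,
      Fintype.card_fin, nsmul_eq_mul] at this
    have h := mul_le_mul_of_nonneg_left (integral_abs_inner_le v) (Nat.cast_nonneg (α := ℝ) n)
    linarith
  · have := c3 v hv
    simp only [Pi.neg_apply, integral_neg, integral_min_abs_inner hv1, Finset.sum_sub_distrib,
      Finset.sum_neg_distrib, Finset.sum_const, Finset.card_univ,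
      Fintype.card_fin, nsmul_eq_mul] at this
    linarith

/-! ### The exponential mechanism -/

open Classical in
/-- The exponential mechanism with base measure `ν` and a bounded score `s`. -/
lemma exists_isPureDP_exponential {X Y : Type*} [MeasurableSpace X] [MeasurableSpace Y] {n : ℕ}
    (ν : Measure Y) [IsFiniteMeasure ν] (hν : ν ≠ 0) {s : (Fin n → X) → Y → ℝ}
    (hs : Measurable fun p : (Fin n → X) × Y => s p.1 p.2) {lo hi : ℝ}
    (hlo : ∀ D y, lo ≤ s D y) (hhi : ∀ D y, s D y ≤ hi) {ε : ℝ}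
    (sens : ∀ D D' : Fin n → X, hammingDist D D' ≤ 1 → ∀ y, s D y ≤ s D' y + ε / 2) :
    ∃ M : Kernel (Fin n → X) Y, IsPureDP ε M ∧
      ∀ (D : Fin n → X) (G B : Set Y) (p q : ℝ), MeasurableSet G → MeasurableSet B →
        (∀ y ∈ G, p ≤ s D y) → (∀ y ∈ B, s D y ≤ q) →
        M D B * ν G ≤ ENNReal.ofReal (Real.exp (q - p)) * ν Set.univ := by
  set w : (Fin n → X) → Y → ℝ≥0∞ := fun D y => ENNReal.ofReal (Real.exp (s D y)) with hw
  have mw : Measurable fun p : (Fin n → X) × Y => w p.1 p.2 := by fun_prop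
  have mwD : ∀ D, Measurable (w D) := fun D => mw.comp measurable_prodMk_left
  set Z : (Fin n → X) → ℝ≥0∞ := fun D => ∫⁻ y, w D y ∂ν with hZ
  have mZ : Measurable Z := mw.lintegral_prod_right'
  have lower : ∀ D (G : Set Y) (p : ℝ), MeasurableSet G → (∀ y ∈ G, p ≤ s D y) →
      ENNReal.ofReal (Real.exp p) * ν G ≤ Z D := by
    intro D G p hG h
    rw [← setLIntegral_const]
    exact (setLIntegral_mono (mwD D) fun y hy =>
      ENNReal.ofReal_le_ofReal (Real.exp_le_exp.2 (h y hy))).trans (setLIntegral_le_lintegral _ _)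
  have Z0 : ∀ D, Z D ≠ 0 := by
    intro D h
    have := lower D Set.univ lo MeasurableSet.univ fun y _ => hlo D y
    rw [h, nonpos_iff_eq_zero, mul_eq_zero] at this
    rcases this with h | h
    · simp only [ENNReal.ofReal_eq_zero] at h
      linarith [Real.exp_pos lo]
    · exact hν (Measure.measure_univ_eq_zero.1 h)
  have upper : ∀ D (B : Set Y) (q : ℝ), MeasurableSet B → (∀ y ∈ B, s D y ≤ q) →
      ∫⁻ y in B, w D y ∂ν ≤ ENNReal.ofReal (Real.exp q) * ν Set.univ := by
    intro D B q hB h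
    calc ∫⁻ y in B, w D y ∂ν ≤ ∫⁻ _ in B, ENNReal.ofReal (Real.exp q) ∂ν :=
          setLIntegral_mono measurable_const fun y hy =>
            ENNReal.ofReal_le_ofReal (Real.exp_le_exp.2 (h y hy))
      _ ≤ _ := by
          rw [setLIntegral_const]
          exact mul_le_mul' le_rfl (measure_mono (Set.subset_univ _))
  have Ztop : ∀ D, Z D ≠ ⊤ := by
    intro D
    have := upper D Set.univ hi MeasurableSet.univ fun y _ => hhi D y
    rw [Measure.restrict_univ] at this
    exact ne_top_of_le_ne_top (ENNReal.mul_ne_top ENNReal.ofReal_ne_top (measure_ne_top _ _)) this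
  have mf : Measurable (Function.uncurry fun D y => w D y * (Z D)⁻¹) :=
    mw.mul (mZ.comp measurable_fst).inv
  let M : Kernel (Fin n → X) Y := Kernel.withDensity (Kernel.const _ ν) fun D y => w D y * (Z D)⁻¹
  have hM : ∀ D T, M D T = (∫⁻ y in T, w D y ∂ν) * (Z D)⁻¹ := by
    intro D T
    rw [Kernel.withDensity_apply' _ mf, Kernel.const_apply, lintegral_mul_const _ (mwD D)]
  refine ⟨M, ⟨⟨fun D => ⟨?_⟩⟩, fun D D' h T hT => ?_⟩, fun D G B p q hG hB hp hq => ?_⟩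
  · rw [hM, Measure.restrict_univ]
    exact ENNReal.mul_inv_cancel (Z0 D) (Ztop D)
  -- The density and the normalizing constant each cost a factor `exp(ε/2)`.
  · set e := ENNReal.ofReal (Real.exp (ε / 2)) with he
    have e0 : e ≠ 0 := by simp [he, Real.exp_pos]
    have etop : e ≠ ⊤ := ENNReal.ofReal_ne_top
    have step : ∀ D D' : Fin n → X, hammingDist D D' ≤ 1 → ∀ y, w D y ≤ e * w D' y := by
      intro D D' h y
      rw [he, hw, ← ENNReal.ofReal_mul (Real.exp_pos _).le, ← Real.exp_add]
      refine ENNReal.ofReal_le_ofReal (Real.exp_le_exp.2 ?_)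
      linarith [sens D D' h y]
    have h1 : ∫⁻ y in T, w D y ∂ν ≤ e * ∫⁻ y in T, w D' y ∂ν := by
      rw [← lintegral_const_mul _ (mwD D')]
      exact lintegral_mono fun y => step D D' h y
    have h2 : Z D' ≤ e * Z D := by
      rw [hZ, ← lintegral_const_mul _ (mwD D)]
      exact lintegral_mono fun y => step D' D (by rwa [hammingDist_comm]) y
    have h3 : (Z D)⁻¹ ≤ e * (Z D')⁻¹ := by
      have : (e * Z D)⁻¹ ≤ (Z D')⁻¹ := ENNReal.inv_le_inv.2 h2
      calc (Z D)⁻¹ = e * (e * Z D)⁻¹ := by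
            rw [ENNReal.mul_inv (Or.inl e0) (Or.inl etop), ← mul_assoc,
              ENNReal.mul_inv_cancel e0 etop, one_mul]
        _ ≤ _ := mul_le_mul' le_rfl this
    have h4 : ENNReal.ofReal (Real.exp ε) = e * e := by
      rw [he, ← ENNReal.ofReal_mul (Real.exp_pos _).le, ← Real.exp_add, add_halves]
    rw [hM, hM, h4]
    calc _ ≤ (e * ∫⁻ y in T, w D' y ∂ν) * (e * (Z D')⁻¹) := mul_le_mul' h1 h3
      _ = _ := by ring
  · have h1 := lower D G p hG hp
    have h2 := upper D B q hB hq
    have h3 : ν G ≤ ENNReal.ofReal (Real.exp (-p)) * Z D := by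
      calc ν G = ENNReal.ofReal (Real.exp (-p)) * (ENNReal.ofReal (Real.exp p) * ν G) := by
            rw [← mul_assoc, ← ENNReal.ofReal_mul (Real.exp_pos _).le, ← Real.exp_add]
            simp
        _ ≤ _ := mul_le_mul' le_rfl h1
    rw [hM]
    calc _ ≤ (ENNReal.ofReal (Real.exp q) * ν Set.univ * (Z D)⁻¹) *
          (ENNReal.ofReal (Real.exp (-p)) * Z D) := mul_le_mul' (mul_le_mul' h2 le_rfl) h3
      _ = ENNReal.ofReal (Real.exp q) * ENNReal.ofReal (Real.exp (-p)) * ν Set.univ *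
          ((Z D)⁻¹ * Z D) := by ring
      _ = _ := by
          rw [ENNReal.inv_mul_cancel (Z0 D) (Ztop D), mul_one,
            ← ENNReal.ofReal_mul (Real.exp_pos _).le, ← Real.exp_add, sub_eq_add_neg]

/-! ### Whitening -/

open scoped MatrixOrder in
-- Take `A = S^{1/2}`. Then `‖A u‖² - ‖u‖² = ⟪u, (S - 1) u⟫ ≥ 0`, which gives expansion, hence
-- injectivity and, in finite dimension, surjectivity.
lemma exists_whitening {d : ℕ} {S : Matrix (Fin d) (Fin d) ℝ} (hS : (S - 1).PosSemidef) :
    ∃ A : EuclideanSpace ℝ (Fin d) →L[ℝ] EuclideanSpace ℝ (Fin d),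
      (∀ μ, multivariateGaussian μ S =
        (stdGaussian (EuclideanSpace ℝ (Fin d))).map fun x => μ + A x) ∧
      (∀ x y, ⟪A x, y⟫ = ⟪x, A y⟫) ∧ Function.Surjective A ∧ (∀ u, ‖u‖ ≤ ‖A u‖) ∧
      ∀ u, mahalanobisNorm S (A u) = ‖u‖ := by
  have hS0 : S.PosSemidef := by
    have := hS.add Matrix.PosSemidef.one
    rwa [sub_add_cancel] at this
  set A := Matrix.toEuclideanCLM (𝕜 := ℝ) (CFC.sqrt S) with hA
  have hself : IsSelfAdjoint A := (CFC.sqrt_nonneg S).isSelfAdjoint.map _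
  have hsymm : ∀ x y, ⟪A x, y⟫ = ⟪x, A y⟫ := fun x y => by
    rw [← ContinuousLinearMap.adjoint_inner_right, hself.adjoint_eq]
  have hAA : ∀ x, A (A x) = Matrix.toEuclideanCLM (𝕜 := ℝ) S x := by
    intro x
    rw [← ContinuousLinearMap.comp_apply, ← ContinuousLinearMap.mul_def, hA, ← map_mul,
      CFC.sqrt_mul_sqrt_self _ hS0.nonneg]
  have hSu : ∀ u : EuclideanSpace ℝ (Fin d),
      ⟪u, Matrix.toEuclideanCLM (𝕜 := ℝ) (S - 1) u⟫ = ‖A u‖ ^ 2 - ‖u‖ ^ 2 := by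
    intro u
    rw [map_sub, map_one, sub_apply, inner_sub_right, ← hAA, ← hsymm,
      real_inner_self_eq_norm_sq]
    simp
  have hnorm : ∀ u, ‖u‖ ≤ ‖A u‖ := by
    intro u
    have h1 := hS.dotProduct_mulVec_nonneg u.ofLp
    have h2 := hSu u
    rw [Matrix.inner_toEuclideanCLM] at h2
    simp only [star_trivial] at h1
    have h3 : ‖u‖ ^ 2 ≤ ‖A u‖ ^ 2 := by linarith
    exact le_of_sq_le_sq h3 (norm_nonneg _)
  have hinj : Function.Injective A := by
    rw [injective_iff_map_eq_zero]
    intro u hu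
    have := hnorm u
    rw [hu, norm_zero] at this
    exact norm_le_zero_iff.1 this
  have hsurj : Function.Surjective A :=
    LinearMap.surjective_of_injective (f := (A : EuclideanSpace ℝ (Fin d) →ₗ[ℝ] _)) hinj
  refine ⟨A, fun μ => rfl, hsymm, hsurj, hnorm, fun u => ?_⟩
  obtain ⟨y, rfl⟩ := hsurj u
  have hunit : IsUnit S.det := by
    have := Matrix.PosDef.one.add_posSemidef hS
    rw [add_sub_cancel] at this
    exact (Matrix.isUnit_iff_isUnit_det _).1 this.isUnit
  have h1 : S⁻¹.mulVec (A (A y)).ofLp = y.ofLp := by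
    rw [hAA, Matrix.ofLp_toEuclideanCLM, Matrix.mulVec_mulVec, Matrix.nonsing_inv_mul _ hunit,
      Matrix.one_mulVec]
  rw [mahalanobisNorm, h1]
  have h2 : (A (A y)).ofLp ⬝ᵥ y.ofLp = ‖A y‖ ^ 2 := by
    rw [← real_inner_self_eq_norm_sq, hsymm, EuclideanSpace.inner_eq_star_dotProduct, star_trivial]
  rw [h2, Real.sqrt_sq (norm_nonneg _)]

/-! ### The estimator -/

lemma le_outputLaw_map {X X' Y : Type*} [MeasurableSpace X] [MeasurableSpace X']
    [MeasurableSpace Y] {n : ℕ} {M : Kernel (Fin n → X) Y} (hM : IsMarkovKernel M)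
    {P : Measure X'} [IsProbabilityMeasure P] {g : X' → X} (hg : Measurable g)
    {A : Set Y} (hA : MeasurableSet A) {β : ℝ} (hβ : 0 ≤ β) (hβ1 : β ≤ 1)
    {R : Set (Fin n → X')} (hR : (Measure.pi fun _ : Fin n => P) Rᶜ ≤ ENNReal.ofReal (β / 2))
    (h : ∀ Z ∈ R, M (fun i => g (Z i)) Aᶜ ≤ ENNReal.ofReal (β / 2)) :
    ENNReal.ofReal (1 - β) ≤ outputLaw M (P.map g) A := by
  have := Measure.isProbabilityMeasure_map (μ := P) hg.aemeasurable
  have hG : Measurable fun (Z : Fin n → X') i => g (Z i) := by fun_prop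
  set Q := Measure.pi fun _ : Fin n => P
  have sub : ENNReal.ofReal (1 - β / 2) = 1 - ENNReal.ofReal (β / 2) := by
    rw [ENNReal.ofReal_sub _ (by linarith), ENNReal.ofReal_one]
  -- `R` need not be measurable, so subadditivity replaces the complement rule; `R` is then enlarged
  -- to a measurable superset.
  have h1 : ENNReal.ofReal (1 - β / 2) ≤ Q R := by
    rw [sub, tsub_le_iff_right]
    calc (1 : ℝ≥0∞) = Q Set.univ := measure_univ.symm
      _ = Q (R ∪ Rᶜ) := by rw [Set.union_compl_self]
      _ ≤ _ := (measure_union_le _ _).trans (add_le_add le_rfl hR)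
  have h2 : R ⊆ {Z | ENNReal.ofReal (1 - β / 2) ≤ M (fun i => g (Z i)) A} := by
    intro Z hZ
    show _ ≤ M (fun i => g (Z i)) A
    rw [sub, ← compl_compl A, prob_compl_eq_one_sub hA.compl]
    exact tsub_le_tsub_left (h Z hZ) 1
  have mM := M.measurable_coe hA
  rw [outputLaw, Measure.bind_apply hA M.measurable.aemeasurable,
    ← Measure.pi_map_pi (fun _ => hg.aemeasurable), lintegral_map mM hG]
  calc ENNReal.ofReal (1 - β) ≤ ENNReal.ofReal (1 - β / 2) * ENNReal.ofReal (1 - β / 2) := by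
        rw [← ENNReal.ofReal_mul (by linarith)]
        exact ENNReal.ofReal_le_ofReal (by nlinarith)
    _ ≤ ENNReal.ofReal (1 - β / 2) *
        Q {Z | ENNReal.ofReal (1 - β / 2) ≤ M (fun i => g (Z i)) A} :=
        mul_le_mul' le_rfl (h1.trans (measure_mono h2))
    _ ≤ _ := mul_meas_ge_le_lintegral (mM.comp hG) _

lemma measurable_mahalanobisNorm_sub {d : ℕ} (S : Matrix (Fin d) (Fin d) ℝ)
    (μ : EuclideanSpace ℝ (Fin d)) : Measurable fun t => mahalanobisNorm S (t - μ) := by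
  have : Continuous fun t : EuclideanSpace ℝ (Fin d) => mahalanobisNorm S (t - μ) := by
    unfold mahalanobisNorm
    refine Real.continuous_sqrt.comp (Continuous.dotProduct ?_ (Continuous.matrix_mulVec ?_ ?_)) <;>
      fun_prop
  exact this.measurable

/-- The factor 8 makes the exponent `d/2 - 4(d + log(1/β)) ≤ -2 - log(1/β)`, and `3e⁻² ≤ 1/2`. -/
lemma measure_not_isRegularSample_le_half {d n : ℕ} (hd : 0 < d) (hn : 0 < n) {β : ℝ}
    (hβ : 0 < β) (hβ1 : β < 1) :
    (Measure.pi fun _ : Fin n => stdGaussian (EuclideanSpace ℝ (Fin d)))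
        {Z | ¬ IsRegularSample (8 * √((d + Real.log (1 / β)) / n)) Z} ≤
      ENNReal.ofReal (β / 2) := by
  have hL : 0 ≤ Real.log (1 / β) := Real.log_nonneg (by rw [le_div_iff₀ hβ]; linarith)
  have hd1 : (1 : ℝ) ≤ d := by exact_mod_cast hd
  have hn0 : (0 : ℝ) < n := by exact_mod_cast hn
  refine (measure_not_isRegularSample_le hn (by positivity)).trans ?_
  rw [show (3 : ℝ≥0∞) = ENNReal.ofReal 3 by simp, ← ENNReal.ofReal_mul (by norm_num)]
  refine ENNReal.ofReal_le_ofReal ?_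
  rw [mul_pow, Real.sq_sqrt (by positivity)]
  have e : (d : ℝ) / 2 - n * (8 ^ 2 * ((d + Real.log (1 / β)) / n)) / 16 =
      d / 2 - 4 * (d + Real.log (1 / β)) := by
    field_simp
    ring
  have e2 : Real.exp (-Real.log (1 / β)) = β := by
    rw [one_div, Real.log_inv, neg_neg, Real.exp_log hβ]
  rw [e]
  calc 3 * Real.exp (d / 2 - 4 * (d + Real.log (1 / β)))
      ≤ 3 * Real.exp (-2 + -Real.log (1 / β)) := by
        gcongr
        linarith
    _ = 3 * Real.exp (-2) * β := by rw [Real.exp_add, e2]; ring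
    _ ≤ 1 / 2 * β := by
        gcongr
        have h1 : (6 : ℝ) ≤ Real.exp 2 := by
          have := Real.exp_one_gt_d9
          rw [show (2 : ℝ) = 1 + 1 by norm_num, Real.exp_add]
          nlinarith
        rw [Real.exp_neg, ← div_eq_mul_inv, div_le_iff₀ (Real.exp_pos _)]
        linarith
    _ = β / 2 := by ring

/-- The absolute constant of the error bound. -/
noncomputable def errorConst : ℝ :=
  256 / (truncMean / 12) + 16 * scoreSensitivity / (truncMean / 12)

lemma errorConst_spec : 1 ≤ errorConst ∧ 256 ≤ errorConst * (truncMean / 12) ∧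
    16 * scoreSensitivity ≤ errorConst * (truncMean / 12) := by
  have h0 := truncMean_pos
  have h1 := truncMean_le_one
  have h2 := scoreSensitivity_pos
  have e : errorConst * (truncMean / 12) = 256 + 16 * scoreSensitivity := by
    rw [errorConst, ← add_div, div_mul_cancel₀ _ (by positivity)]
  refine ⟨?_, by linarith, by linarith⟩
  by_contra h
  nlinarith

/-- The logarithm in `privacyCost` is designed to cancel the volume factor `(ρn/d)^d`; the spare
`2^{-d}` is at most `1/2` because `d ≥ 1`. -/
lemma exp_mul_pow_le {d n : ℕ} (hd : 0 < d) (hn : 0 < n) {ρ β x y : ℝ} (hρ : 0 < ρ) (hβ : 0 < β)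
    (hx : x ≤ -privacyCost d n ρ β) (hy : 0 ≤ y) (hy' : y ≤ ρ * n / d / 2) :
    Real.exp x * y ^ d ≤ β / 2 := by
  have hd0 : (0 : ℝ) < d := by exact_mod_cast hd
  have hn0 : (0 : ℝ) < n := by exact_mod_cast hn
  have hq : 0 < ρ * n / d := by positivity
  have e : Real.exp (-privacyCost d n ρ β) = ((ρ * n / d) ^ d)⁻¹ * β := by
    rw [privacyCost, neg_add, Real.exp_add, one_div, Real.log_inv, neg_neg, Real.exp_log hβ,
      Real.exp_neg, Real.exp_nat_mul, Real.exp_log hq]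
  calc Real.exp x * y ^ d ≤ (((ρ * n / d) ^ d)⁻¹ * β) * (ρ * n / d / 2) ^ d := by
        rw [← e]; gcongr
    _ = β * (1 / 2) ^ d := by
        rw [div_pow (ρ * n / d), one_div, inv_pow]
        field_simp
    _ ≤ β * (1 / 2) ^ 1 := by
        gcongr _ * ?_
        exact pow_le_pow_of_le_one (by norm_num) (by norm_num) hd
    _ = β / 2 := by ring

lemma errorBound_spec {d n : ℕ} {ρ ε β : ℝ} (hd : 0 < d) (hn : 0 < n)
    (hε : 0 < ε) (hβ : 0 < β) (hβ1 : β < 1) (hpc : 0 ≤ privacyCost d n ρ β)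
    (hα : errorBound errorConst d n ρ ε β ≤ 1) :
    0 < errorBound errorConst d n ρ ε β ∧
      8 * √((d + Real.log (1 / β)) / n) ≤
        truncMean / 12 * errorBound errorConst d n ρ ε β / 32 ∧
      (d : ℝ) / n * 256 ≤ truncMean / 12 * errorBound errorConst d n ρ ε β ∧
      16 * scoreSensitivity * privacyCost d n ρ β ≤
        truncMean / 12 * errorBound errorConst d n ρ ε β * (n * ε) := by
  obtain ⟨hC1, hC2, hC3⟩ := errorConst_spec
  have hl0 : 0 < truncMean / 12 := by have := truncMean_pos; positivity
  have hd0 : (0 : ℝ) < d := by exact_mod_cast hd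
  have hn0 : (0 : ℝ) < n := by exact_mod_cast hn
  have hL : 0 ≤ Real.log (1 / β) := Real.log_nonneg (by rw [le_div_iff₀ hβ]; linarith)
  have hC0 : 0 < errorConst := by linarith
  have hαeq : errorBound errorConst d n ρ ε β = errorConst * √((d + Real.log (1 / β)) / n) +
      errorConst * (privacyCost d n ρ β / (n * ε)) := by
    rw [errorBound, mul_add]
  set α := errorBound errorConst d n ρ ε β
  set a := √((d + Real.log (1 / β)) / n) with ha
  set l := truncMean / 12
  set C := errorConst
  set pc := privacyCost d n ρ β
  have ha0 : 0 < a := Real.sqrt_pos.2 (by positivity)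
  have hpos : 0 ≤ C * (pc / (n * ε)) := by positivity
  have hαa : C * a ≤ α := by linarith
  have hαp : C * pc ≤ α * (n * ε) := by
    have : C * (pc / (n * ε)) ≤ α := by
      have : 0 ≤ C * a := by positivity
      linarith
    rwa [← mul_div_assoc, div_le_iff₀ (by positivity)] at this
  have ha256 : 256 * a ≤ l * α := by
    calc 256 * a ≤ C * l * a := by gcongr
      _ = l * (C * a) := by ring
      _ ≤ l * α := by gcongr
  -- As `α ≤ 1` forces `d/n ≤ 1`, the ratio `d/n` is at most its own square root.
  have hdn : (d : ℝ) / n ≤ a := by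
    have h0 : (d + Real.log (1 / β)) / n ≤ 1 := by
      have h1 : a ≤ 1 := by nlinarith
      rw [ha, Real.sqrt_le_left zero_le_one, one_pow] at h1
      exact h1
    have h1 : (d : ℝ) / n ≤ (d + Real.log (1 / β)) / n := by gcongr; linarith
    refine Real.le_sqrt_of_sq_le (le_trans ?_ h1)
    have : 0 ≤ (d : ℝ) / n := by positivity
    nlinarith
  refine ⟨lt_of_lt_of_le (by positivity) hαa, by linarith, by linarith, ?_⟩
  calc 16 * scoreSensitivity * pc ≤ C * l * pc := by gcongr
    _ = l * (C * pc) := by ring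
    _ ≤ l * (α * (n * ε)) := by gcongr
    _ = _ := by ring

lemma le_ofReal_of_mul_volume_ball_le {d : ℕ} (hd : 0 < d) {x : EuclideanSpace ℝ (Fin d)}
    {r s c : ℝ} (hr : 0 < r) (hs : 0 ≤ s) (hc : 0 ≤ c) {m : ℝ≥0∞}
    (h : m * volume (Metric.ball x r) ≤
      ENNReal.ofReal c * volume (Metric.ball (0 : EuclideanSpace ℝ (Fin d)) s)) :
    m ≤ ENNReal.ofReal (c * (s / r) ^ d) := by
  have : Nonempty (Fin d) := ⟨⟨0, hd⟩⟩
  have hκ0 : volume (Metric.ball (0 : EuclideanSpace ℝ (Fin d)) 1) ≠ 0 :=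
    (Metric.measure_ball_pos _ _ one_pos).ne'
  have hκtop : volume (Metric.ball (0 : EuclideanSpace ℝ (Fin d)) 1) ≠ ⊤ :=
    measure_ball_lt_top.ne
  rw [Measure.addHaar_ball _ _ hr.le, Measure.addHaar_ball _ _ hs, finrank_euclideanSpace_fin,
    ← mul_assoc, ← mul_assoc, ENNReal.mul_le_mul_iff_left hκ0 hκtop,
    ← ENNReal.ofReal_mul hc] at h
  have hrd : 0 < r ^ d := by positivity
  rw [div_pow, ← mul_div_assoc, ENNReal.ofReal_div_of_pos hrd]
  rwa [ENNReal.le_div_iff_mul_le (Or.inl (ENNReal.ofReal_pos.2 hrd).ne')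
    (Or.inl ENNReal.ofReal_ne_top)]

/-- A pure differentially private estimator which is accurate for all Gaussians with covariance at
least the identity and with mean well inside the ball of radius `2 * ρ`. -/
lemma exists_private_gaussian_mean_estimator {d n : ℕ} {ρ ε β : ℝ} (hd : 0 < d) (hn : 0 < n)
    (hρ : 0 < ρ) (hε : 0 < ε) (hβ : 0 < β) (hβ1 : β < 1) (hpc : 0 ≤ privacyCost d n ρ β)
    (hα : errorBound errorConst d n ρ ε β ≤ 1) :
    ∃ M : Kernel (Fin n → EuclideanSpace ℝ (Fin d)) (EuclideanSpace ℝ (Fin d)),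
      IsPureDP ε M ∧
      ∀ (μ : EuclideanSpace ℝ (Fin d)) (S : Matrix (Fin d) (Fin d) ℝ),
        ‖μ‖ + errorBound errorConst d n ρ ε β ≤ 2 * ρ → (S - 1).PosSemidef →
        ENNReal.ofReal (1 - β) ≤ outputLaw M (multivariateGaussian μ S)
          {t | mahalanobisNorm S (t - μ) ≤ errorBound errorConst d n ρ ε β} := by
  obtain ⟨hα0, hbα, hdn, hαp⟩ := errorBound_spec hd hn hε hβ hβ1 hpc hα
  have hhalf := measure_not_isRegularSample_le_half hd hn hβ hβ1
  set α := errorBound errorConst d n ρ ε β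
  have hb0 : 0 ≤ 8 * √((d + Real.log (1 / β)) / n) := by positivity
  generalize 8 * √((d + Real.log (1 / β)) / n) = b at hbα hhalf hb0
  have hc0 := truncMean_pos
  have hc1 := truncMean_le_one
  have hΔ := scoreSensitivity_pos
  have hd0 : (0 : ℝ) < d := by exact_mod_cast hd
  have hn0 : (0 : ℝ) < n := by exact_mod_cast hn
  have hlα : truncMean / 12 * α ≤ truncMean / 12 := by nlinarith
  -- Small enough that `2b + r` uses at most half of the score gap, large enough that `r ≥ 16 d/n`.
  set r := truncMean / 12 * α / 16 with hr
  have hr0 : 0 < r := by positivity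
  -- Scales the sensitivity of the score to `ε/2`.
  set η := ε / (2 * scoreSensitivity) with hη
  have hη0 : 0 < η := by positivity
  set B := Metric.ball (0 : EuclideanSpace ℝ (Fin d)) (2 * ρ) with hB
  have : IsFiniteMeasure ((volume : Measure (EuclideanSpace ℝ (Fin d))).restrict B) :=
    ⟨by rw [Measure.restrict_apply_univ]; exact measure_ball_lt_top⟩
  have hν : (volume : Measure (EuclideanSpace ℝ (Fin d))).restrict B ≠ 0 := by
    rw [Ne, Measure.restrict_eq_zero]
    exact (Metric.measure_ball_pos _ _ (by positivity)).ne'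
  obtain ⟨M, hM, hacc⟩ := exists_isPureDP_exponential (n := n) (volume.restrict B) hν
    (s := fun X t => η * score X t) (measurable_score.const_mul η) (lo := η * -n) (hi := 0)
    (fun D y => mul_le_mul_of_nonneg_left (neg_card_le_score D y) hη0.le)
    (fun D y => mul_nonpos_of_nonneg_of_nonpos hη0.le (score_nonpos D y)) (ε := ε)
    (fun D D' h y => by
      have h1 := mul_le_mul_of_nonneg_left (score_le_add_scoreSensitivity h y) hη0.le
      have h2 : η * scoreSensitivity = ε / 2 := by
        rw [hη]; field_simp
      linarith)
  refine ⟨M, hM, fun μ S hμ hS => ?_⟩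
  obtain ⟨A, hlaw, hsymm, hsurj, hnorm, hmah⟩ := exists_whitening hS
  have mT : MeasurableSet {t | mahalanobisNorm S (t - μ) ≤ α} :=
    measurableSet_le (measurable_mahalanobisNorm_sub S μ) measurable_const
  rw [hlaw]
  refine le_outputLaw_map (R := {Z | IsRegularSample b Z}) hM.1 (by fun_prop) mT hβ.le
    hβ1.le hhalf fun Z hZ => ?_
  have hscore : ∀ t, ∃ u, t = μ + A u := fun t => by
    obtain ⟨u, hu⟩ := hsurj (t - μ)
    exact ⟨u, by rw [hu, add_sub_cancel]⟩
  have hbad : ∀ t ∈ {t | mahalanobisNorm S (t - μ) ≤ α}ᶜ,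
      η * score (fun i => μ + A (Z i)) t ≤ η * (n * (b - truncMean / 12 * α / 4)) := by
    intro t ht
    obtain ⟨u, rfl⟩ := hscore t
    simp only [Set.mem_compl_iff, Set.mem_ofPred_eq, add_sub_cancel_left, hmah, not_le] at ht
    rw [score_affine hsymm hsurj]
    exact mul_le_mul_of_nonneg_left
      (score_le_of_le_norm (by linarith) hα0 hα hZ ht.le) hη0.le
  have hgood : ∀ t ∈ Metric.ball μ r,
      η * -(n * (b + r)) ≤ η * score (fun i => μ + A (Z i)) t := by
    intro t ht
    obtain ⟨u, rfl⟩ := hscore t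
    rw [mem_ball_iff_norm, add_sub_cancel_left] at ht
    rw [score_affine hsymm hsurj]
    exact mul_le_mul_of_nonneg_left (le_score_of_norm_le (by linarith) hb0
      hr0.le hZ ((hnorm u).trans ht.le)) hη0.le
  have h := hacc _ _ _ _ _ measurableSet_ball mT.compl hgood hbad
  have hrα : r ≤ α := by nlinarith
  have hsub : Metric.ball μ r ⊆ B := by
    intro t ht
    rw [hB, mem_ball_zero_iff]
    rw [mem_ball_iff_norm] at ht
    have := norm_le_norm_add_norm_sub' t μ
    linarith
  rw [Measure.restrict_apply_univ, Measure.restrict_apply measurableSet_ball,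
    Set.inter_eq_left.2 hsub] at h
  refine (le_ofReal_of_mul_volume_ball_le hd hr0 (by positivity) (Real.exp_pos _).le h).trans
    (ENNReal.ofReal_le_ofReal (exp_mul_pow_le hd hn hρ hβ ?_ (by positivity) ?_))
  -- With `b ≤ lα/32` and `r = lα/16`, the gap `lα/4 - 2b - r` is at least `lα/8`.
  · have e1 : η * (n * (b - truncMean / 12 * α / 4)) - η * -(n * (b + r)) =
        -(η * n * (truncMean / 12 * α / 4 - 2 * b - r)) := by ring
    have e2 : η * n * (truncMean / 12 * α / 8) =
        truncMean / 12 * α * (n * ε) / (16 * scoreSensitivity) := by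
      rw [hη]; field_simp; norm_num
    rw [e1]
    refine neg_le_neg (le_trans ?_ (mul_le_mul_of_nonneg_left
      (by linarith : truncMean / 12 * α / 8 ≤ truncMean / 12 * α / 4 - 2 * b - r)
      (by positivity)))
    rw [e2, le_div_iff₀ (by positivity)]
    linarith
  · have h1 : (d : ℝ) / n * 16 ≤ r := by linarith
    have h2 : ρ * n / d / 2 * (d / n * 16) = 8 * ρ := by field_simp; norm_num
    have h3 : 0 ≤ ρ * n / d / 2 := by positivity
    rw [div_le_iff₀ hr0]
    have := mul_le_mul_of_nonneg_left h1 h3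
    linarith

/-! ### The general and the spherical bounds -/

theorem corollary6p3 :
    -- unknown covariance, Mahalanobis error
    (∃ C : ℝ, 1 ≤ C ∧
      ∀ (d n : ℕ) (R κ ε β : ℝ), 0 < d → 0 < n → 0 ≤ R → 1 ≤ κ →
        0 < ε → ε < 1 → 0 < β → β < 1 →
        0 ≤ privacyCost d n (R + Real.sqrt κ) β →
        errorBound C d n (R + Real.sqrt κ) ε β ≤ 1 →
        ∃ M : Kernel (Fin n → EuclideanSpace ℝ (Fin d)) (EuclideanSpace ℝ (Fin d)),
          IsPureDP ε M ∧
          ∀ (μ : EuclideanSpace ℝ (Fin d)) (S : Matrix (Fin d) (Fin d) ℝ),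
            ‖μ‖ ≤ R → (S - 1).PosSemidef → (κ • (1 : Matrix (Fin d) (Fin d) ℝ) - S).PosSemidef →
            ENNReal.ofReal (1 - β) ≤
              outputLaw M (multivariateGaussian μ S)
                {t | mahalanobisNorm S (t - μ) ≤
                  errorBound C d n (R + Real.sqrt κ) ε β}) ∧
    -- identity covariance, Euclidean error
    (∃ C : ℝ, 1 ≤ C ∧
      ∀ (d n : ℕ) (R ε β : ℝ), 0 < d → 0 < n → 0 < R →
        0 < ε → ε < 1 → 0 < β → β < 1 →
        0 ≤ privacyCost d n R β →
        errorBound C d n R ε β ≤ 1 →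
        ∃ M : Kernel (Fin n → EuclideanSpace ℝ (Fin d)) (EuclideanSpace ℝ (Fin d)),
          IsPureDP ε M ∧
          ∀ μ : EuclideanSpace ℝ (Fin d), ‖μ‖ ≤ R →
            ENNReal.ofReal (1 - β) ≤
              outputLaw M (multivariateGaussian μ (1 : Matrix (Fin d) (Fin d) ℝ))
                {t | ‖t - μ‖ ≤ errorBound C d n R ε β}) := by
  obtain ⟨hC1, -, -⟩ := errorConst_spec
  refine ⟨⟨errorConst, hC1, ?_⟩, ⟨errorConst, hC1, ?_⟩⟩
  · intro d n R κ ε β hd hn hR hκ hε _ hβ hβ1 hpc hα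
    have hκ1 : 1 ≤ √κ := Real.one_le_sqrt.2 hκ
    obtain ⟨M, hM, hacc⟩ := exists_private_gaussian_mean_estimator hd hn
      (by linarith : 0 < R + √κ) hε hβ hβ1 hpc hα
    -- The base ball is large enough since `‖μ‖ + α ≤ R + 1 ≤ 2(R + √κ)`.
    exact ⟨M, hM, fun μ S hμ hS _ => hacc μ S (by linarith) hS⟩
  · intro d n R ε β hd hn hR hε _ hβ hβ1 hpc hα
    -- If `R ≤ α`, the constant answer `0` is accurate and private; otherwise `‖μ‖ + α ≤ 2R`, as the
    -- general estimator requires.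
    rcases le_total R (errorBound errorConst d n R ε β) with h | h
    · refine ⟨Kernel.const _ (Measure.dirac 0), ⟨inferInstance, fun D D' _ T _ => ?_⟩,
        fun μ hμ => ?_⟩
      · rw [Kernel.const_apply, Kernel.const_apply]
        exact le_mul_of_one_le_left zero_le
          (ENNReal.one_le_ofReal.2 (Real.one_le_exp hε.le))
      · rw [outputLaw, Measure.const_comp, measure_univ, one_smul, Measure.dirac_apply_of_mem]
        · rw [← ENNReal.ofReal_one]
          exact ENNReal.ofReal_le_ofReal (by linarith)
        · show ‖0 - μ‖ ≤ _
          rw [zero_sub, norm_neg]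
          exact hμ.trans h
    · obtain ⟨M, hM, hacc⟩ := exists_private_gaussian_mean_estimator hd hn hR hε hβ hβ1 hpc hα
      refine ⟨M, hM, fun μ hμ => ?_⟩
      have h1 := hacc μ 1 (by linarith) (by rw [sub_self]; exact Matrix.PosSemidef.zero)
      have e : ∀ v : EuclideanSpace ℝ (Fin d), mahalanobisNorm 1 v = ‖v‖ := fun v => by
        rw [mahalanobisNorm, inv_one, Matrix.one_mulVec, EuclideanSpace.norm_eq]
        simp [dotProduct, sq]
      simpa only [e] using h1
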